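/- **Theorem 4 (Jordan–Schrödinger equation).** Let $\hbar,m,\Omega_+,\Omega_->0$. For each sign $\pm$ let $\mathscr H_\pm$ be a complex Hilbert space with an orthonormal basis of number states $|n\rangle$, $n=0,1,2,\dots$, and let $A_\pm|n\rangle=\sqrt n\,|n-1\rangle$, $A_\pm^\dagger|n\rangle=\sqrt{n+1}\,|n+1\rangle$ be the annihilation and creation operators on the span of the number states. Put $H_\pm=\hbar\Omega_\pm(A_\pm^\dagger A_\pm+\tfrac12)$, $C_{1\pm}=\sqrt{\hbar/(2m\Omega_\pm)}$, $C_{2\pm}=\sqrt{\hbar m\Omega_\pm/2}$, $X_\pm=C_{1\pm}(A_\pm^\dagger+A_\pm)$, $P_\pm=iC_{2\pm}(A_\pm^\dagger-A_\pm)$ and $$R_{1\pm}=-\tfrac{\Omega_\pm}{4}(X_\pm A_\pm+A_\pm^\dagger X_\pm),\qquad R_{2\pm}=-\tfrac{\Omega_\pm}{4}(2C_{1\pm}P_\pm A_\pm+2C_{1\pm}A_\pm^\dagger P_\pm),$$ $$S_{1\pm}=P_\pm A_\pm+A_\pm^\dagger P_\pm,\qquad S_{2\pm}=A_\pm^\dagger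 A_\pm .$$ Let $\hat{\mathscr H}_{J,\pm}$ be the real Hilbert space of self-adjoint Hilbert–Schmidt operators on $\mathscr H_\pm$ with $\langle v,w\rangle=\mathrm{tr}(v\bullet w)$, where $v\bullet w=\tfrac12(vw+wv)$. Let $L_R v=R\bullet v$ be Jordan multiplication, an unbounded operator on $\hat{\mathscr H}_{J,\pm}$ with its maximal domain (the product being tested against number states), and let $K_\pm=[L_{S_{1\pm}},L_{R_{1\pm}}]+[L_{S_{2\pm}},L_{R_{2\pm}}]$ on its natural domain. Then: 1. $H_\pm=i[R_{1\pm},S_{1\pm}]+i[R_{2\pm},S_{2\pm}]$ on the span of the number states. 2. $H_\pm$ and $K_\pm$ are closable, and with their closures denoted by the same letters, $-\tfrac{i}{\hbar}H_\pm$ and $-\tfrac4\hbar K_\pm$ generate unique strongly continuous one-parameter groups $U_\pm(t)=e^{-itH_\pm/\hbar}$ on $\mathscr H_\pm$ and $e^{-\frac{4t}{\hbar}K_\pm}$ on $\hat{\mathscr H}_{J,\pm}$. 3. For every state vector $v_+\otimes v_-$ in the Hilbert tensor product $\hat{\mathscr H}_{J,+}\otimes\hat{\mathscr H}_{J,-}$,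 its time evolution under $H_+\otimes\mathbb I+\mathbb I\otimes H_-$ (the generator of the product group) is $$(U_+(t)\otimes U_-(t))\,(v_+\otimes v_-)\,(U_+(t)\otimes U_-(t))^*=e^{-\frac{4t}{\hbar}K_+}v_+\otimes e^{-\frac{4t}{\hbar}K_-}v_-\qquad(t\in\mathbb R).$$ 4. If $v_\pm(0)$ lies in the domain of the closure of $K_\pm$, then $v_\pm(t)=e^{-\frac{4t}{\hbar}K_\pm}v_\pm(0)$ stays in that domain and satisfies $$\frac{d}{dt}(v_+\otimes v_-)=-\frac4\hbar\Big(\big([L_{S_{1+}},L_{R_{1+}}]+[L_{S_{2+}},L_{R_{2+}}]\big)v_+\otimes v_-+v_+\otimes\big([L_{S_{1-}},L_{R_{1-}}]+[L_{S_{2-}},L_{R_{2-}}]\big)v_-\Big)$$ for all $t$, in the norm of the Hilbert tensor product. If $v_\pm(0)$ have only finitely many nonzero matrix elements between number states, no closure is needed: $v_\pm(t)$ stays in the natural domain of $K_\pm$. 5. Conversely, every solution $v_+(t)\otimes v_-(t)$ of this equation on $\mathbb R$, with $v_\pm(t)$ in the domain of the closure of $K_\pm$, is $e^{-\frac{4t}{\hbar}K_+}v_+(0)\otimes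 e^{-\frac{4t}{\hbar}K_-}v_-(0)$. -/

import Mathlib

open scoped TensorProduct InnerProductSpace

noncomputable section

/-! ## Unbounded operators and their exponentials -/

section UnboundedOperators

variable {𝕜 : Type*} [RCLike 𝕜] {V : Type*} [NormedAddCommGroup V] [NormedSpace 𝕜 V]

/-- Composition `g ∘ f` of two partially defined operators, on its natural domain
`{x ∈ dom f | f x ∈ dom g}`. -/
def pcomp (g f : V →ₗ.[𝕜] V) : V →ₗ.[𝕜] V :=
  g.comp
    (f.domRestrict ((g.domain.comap f.toFun).map f.domain.subtype))
    (by
      rintro ⟨x, hx⟩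
      obtain ⟨y, hy, hyx⟩ := hx.1
      have h : f.domRestrict ((g.domain.comap f.toFun).map f.domain.subtype) ⟨x, hx⟩ = f y :=
        LinearPMap.domRestrict_apply hyx.symm
      rw [h]
      exact hy)

/-- The commutator `[g, f] = g f - f g`, on the natural domain `dom (g f) ∩ dom (f g)`. -/
def pcommutator (g f : V →ₗ.[𝕜] V) : V →ₗ.[𝕜] V := pcomp g f - pcomp f g

/-- `T t = exp (t G)` for all real `t`: `T` is a strongly continuous one-parameter group of bounded
operators and `G` is exactly its infinitesimal generator. -/
structure IsOpExp [NormedSpace ℝ V] (G : V →ₗ.[𝕜] V) (T : ℝ → V →L[𝕜] V) : Prop where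
  map_zero : T 0 = 1
  map_add : ∀ s t, T (s + t) = T s * T t
  continuous : ∀ x, Continuous fun t => T t x
  generator : ∀ x y, HasDerivAt (fun t => T t x) y 0 ↔ (x, y) ∈ G.graph

open Classical in
/-- The operator `exp (t G)`, for `G` the generator of a strongly continuous group
(and `0` if there is no such group). -/
def opExp [NormedSpace ℝ V] (G : V →ₗ.[𝕜] V) : ℝ → V →L[𝕜] V :=
  if h : ∃ T : ℝ → V →L[𝕜] V, IsOpExp G T then h.choose else fun _ => 0

end UnboundedOperators

/-! ## The oscillator on a Hilbert space with basis of number states `φ 0, φ 1, …` -/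

section Oscillator

variable {E : Type*} [NormedAddCommGroup E] [InnerProductSpace ℂ E]

/-- The space of finite linear combinations of number states. -/
abbrev FockSpan (φ : HilbertBasis ℕ ℂ E) : Submodule ℂ E := Submodule.span ℂ (Set.range φ)

/-- The number states, as an algebraic basis of their span. -/
def numberBasis (φ : HilbertBasis ℕ ℂ E) : Module.Basis ℕ ℂ (FockSpan φ) :=
  Module.Basis.span φ.orthonormal.linearIndependent

/-- The annihilation operator, `A |n⟩ = √n |n-1⟩` and `A |0⟩ = 0`. -/
def annih (φ : HilbertBasis ℕ ℂ E) : Module.End ℂ (FockSpan φ) :=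
  (numberBasis φ).constr ℂ fun n => ((Real.sqrt n : ℝ) : ℂ) • numberBasis φ (n - 1)

/-- The creation operator, `A† |n⟩ = √(n+1) |n+1⟩`. -/
def creat (φ : HilbertBasis ℕ ℂ E) : Module.End ℂ (FockSpan φ) :=
  (numberBasis φ).constr ℂ fun n => ((Real.sqrt (n + 1) : ℝ) : ℂ) • numberBasis φ (n + 1)

/-- The Hamiltonian `H = ħ Ω (A† A + 1/2)`. -/
def hamiltonian (φ : HilbertBasis ℕ ℂ E) (ħ Ω : ℝ) : Module.End ℂ (FockSpan φ) :=
  ((ħ * Ω : ℝ) : ℂ) • (creat φ * annih φ + (1 / 2 : ℂ) • (1 : Module.End ℂ (FockSpan φ)))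

/-- `C₁ = √(ħ / (2 m Ω))`. -/
def constC1 (ħ m Ω : ℝ) : ℝ := Real.sqrt (ħ / (2 * m * Ω))

/-- `C₂ = √(ħ m Ω / 2)`. -/
def constC2 (ħ m Ω : ℝ) : ℝ := Real.sqrt (ħ * m * Ω / 2)

/-- The position operator `X = C₁ (A† + A)`. -/
def posOp (φ : HilbertBasis ℕ ℂ E) (ħ m Ω : ℝ) : Module.End ℂ (FockSpan φ) :=
  (constC1 ħ m Ω : ℂ) • (creat φ + annih φ)

/-- The momentum operator `P = i C₂ (A† - A)`. -/
def momOp (φ : HilbertBasis ℕ ℂ E) (ħ m Ω : ℝ) : Module.End ℂ (FockSpan φ) :=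
  (Complex.I * (constC2 ħ m Ω : ℂ)) • (creat φ - annih φ)

/-- `R₁ = -(Ω/4) (X A + A† X)`. -/
def opR1 (φ : HilbertBasis ℕ ℂ E) (ħ m Ω : ℝ) : Module.End ℂ (FockSpan φ) :=
  (-(Ω : ℂ) / 4) • (posOp φ ħ m Ω * annih φ + creat φ * posOp φ ħ m Ω)

/-- `R₂ = -(Ω/4) (2 C₁ P A + 2 C₁ A† P)`. -/
def opR2 (φ : HilbertBasis ℕ ℂ E) (ħ m Ω : ℝ) : Module.End ℂ (FockSpan φ) :=
  (-(Ω : ℂ) / 4) •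
    ((2 * (constC1 ħ m Ω : ℂ)) • (momOp φ ħ m Ω * annih φ) +
      (2 * (constC1 ħ m Ω : ℂ)) • (creat φ * momOp φ ħ m Ω))

/-- `S₁ = P A + A† P`. -/
def opS1 (φ : HilbertBasis ℕ ℂ E) (ħ m Ω : ℝ) : Module.End ℂ (FockSpan φ) :=
  momOp φ ħ m Ω * annih φ + creat φ * momOp φ ħ m Ω

/-- `S₂ = A† A`. -/
def opS2 (φ : HilbertBasis ℕ ℂ E) : Module.End ℂ (FockSpan φ) := creat φ * annih φ

/-- An operator on the span of the number states, as a densely defined operator on the Hilbert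
space. -/
def toUnbounded (φ : HilbertBasis ℕ ℂ E) (T : Module.End ℂ (FockSpan φ)) : E →ₗ.[ℂ] E :=
  ⟨FockSpan φ, (FockSpan φ).subtype ∘ₗ T⟩

/-- The generator `-(i/ħ) H` of the unitary time evolution, with `H` replaced by its closure. -/
def schrodingerGen (φ : HilbertBasis ℕ ℂ E) (ħ Ω : ℝ) : E →ₗ.[ℂ] E :=
  (-(Complex.I / (ħ : ℂ))) • (toUnbounded φ (hamiltonian φ ħ Ω)).closure

/-- The unitary time evolution `exp (-i t H / ħ)`. -/
def unitaryEvolution (φ : HilbertBasis ℕ ℂ E) (ħ Ω : ℝ) : ℝ → E →L[ℂ] E :=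
  opExp (schrodingerGen φ ħ Ω)

end Oscillator

/-! ## The real Hilbert space of self-adjoint Hilbert–Schmidt operators -/

section JordanHilbert

variable {E : Type*} [NormedAddCommGroup E] [InnerProductSpace ℂ E] [CompleteSpace E]

/-- The self-adjoint Hilbert–Schmidt operators: `v* = v` and `tr (v²) = ∑ ‖v φₙ‖² < ∞`. -/
def jordanHSSubmodule (φ : HilbertBasis ℕ ℂ E) : Submodule ℝ (E →L[ℂ] E) where
  carrier := {v | IsSelfAdjoint v ∧ Summable fun n => ‖v (φ n)‖ ^ 2}
  zero_mem' := ⟨IsSelfAdjoint.zero _, by simp⟩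
  add_mem' := by
    rintro a b ⟨ha, ha'⟩ ⟨hb, hb'⟩
    refine ⟨ha.add hb, Summable.of_nonneg_of_le (fun n => by positivity) (fun n => ?_)
      ((ha'.add hb').mul_left 2)⟩
    have h : ‖(a + b) (φ n)‖ ≤ ‖a (φ n)‖ + ‖b (φ n)‖ := norm_add_le _ _
    nlinarith [norm_nonneg ((a + b) (φ n)), sq_nonneg (‖a (φ n)‖ - ‖b (φ n)‖)]
  smul_mem' := by
    rintro c a ⟨ha, ha'⟩
    refine ⟨?_, ?_⟩
    · rw [isSelfAdjoint_iff]
      have e : c • a = ((c : ℝ) : ℂ) • a := by ext x; simp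
      rw [e, star_smul, ha.star_eq]
      simp
    · have e : (fun n => ‖(c • a) (φ n)‖ ^ 2) = fun n => ‖c‖ ^ 2 * ‖a (φ n)‖ ^ 2 := by
        ext n; simp [norm_smul, mul_pow]
      rw [e]; exact ha'.mul_left _

/-- The space of self-adjoint Hilbert–Schmidt operators (with the Hilbert–Schmidt, not the
operator norm). -/
def JordanHS (φ : HilbertBasis ℕ ℂ E) : Type _ := jordanHSSubmodule φ

namespace JordanHS

variable (φ : HilbertBasis ℕ ℂ E)

instance : AddCommGroup (JordanHS φ) := inferInstanceAs (AddCommGroup (jordanHSSubmodule φ))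

instance : Module ℝ (JordanHS φ) := inferInstanceAs (Module ℝ (jordanHSSubmodule φ))

variable {φ}

/-- The underlying bounded operator. -/
def op (v : JordanHS φ) : E →L[ℂ] E := v.1

theorem op_add (v w : JordanHS φ) : (v + w).op = v.op + w.op := rfl

theorem op_smul (c : ℝ) (v : JordanHS φ) : (c • v).op = c • v.op := rfl

theorem op_zero : (0 : JordanHS φ).op = 0 := rfl

theorem op_injective : Function.Injective (op : JordanHS φ → E →L[ℂ] E) := Subtype.val_injective

theorem summable_inner (v w : JordanHS φ) :
    Summable fun n => (⟪v.op (φ n), w.op (φ n)⟫_ℂ).re := by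
  refine Summable.of_norm_bounded (v.2.2.add w.2.2) fun n => ?_
  have h1 : ‖(⟪v.op (φ n), w.op (φ n)⟫_ℂ).re‖ ≤ ‖v.op (φ n)‖ * ‖w.op (φ n)‖ :=
    (Complex.abs_re_le_norm _).trans (norm_inner_le_norm _ _)
  change _ ≤ ‖v.op (φ n)‖ ^ 2 + ‖w.op (φ n)‖ ^ 2
  nlinarith [sq_nonneg (‖v.op (φ n)‖ - ‖w.op (φ n)‖), sq_nonneg (‖v.op (φ n)‖),
    sq_nonneg (‖w.op (φ n)‖)]

/-- The inner product `⟨v, w⟩ = tr (v • w) = Re ∑ ⟪v φₙ, w φₙ⟫`. -/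
abbrev innerCore (φ : HilbertBasis ℕ ℂ E) : InnerProductSpace.Core ℝ (JordanHS φ) where
  inner v w := ∑' n, (⟪v.op (φ n), w.op (φ n)⟫_ℂ).re
  conj_inner_symm v w := by
    simp only [conj_trivial]
    refine tsum_congr fun n => ?_
    rw [← inner_conj_symm, Complex.conj_re]
  re_inner_nonneg v := by
    refine tsum_nonneg fun n => ?_
    exact inner_self_nonneg (𝕜 := ℂ)
  add_left u v w := by
    rw [← (summable_inner u w).tsum_add (summable_inner v w)]
    refine tsum_congr fun n => ?_
    rw [op_add, add_apply, inner_add_left, Complex.add_re]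
  smul_left v w r := by
    simp only [conj_trivial]
    rw [← tsum_mul_left]
    refine tsum_congr fun n => ?_
    rw [op_smul, smul_apply, ← Complex.coe_smul, inner_smul_left, Complex.conj_ofReal,
      Complex.re_ofReal_mul]
  definite v hv := by
    have hnn : ∀ n, 0 ≤ (⟪v.op (φ n), v.op (φ n)⟫_ℂ).re := fun n => inner_self_nonneg (𝕜 := ℂ)
    have h0 := (hasSum_zero_iff_of_nonneg hnn).1 (hv ▸ (summable_inner v v).hasSum)
    apply op_injective
    rw [op_zero]
    refine ContinuousLinearMap.ext_on (s := Set.range φ) ?_ ?_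
    · rw [Submodule.dense_iff_topologicalClosure_eq_top]
      exact φ.dense_span
    · rintro _ ⟨n, rfl⟩
      have h1 : (⟪v.op (φ n), v.op (φ n)⟫_ℂ).re = 0 := congrFun h0 n
      have h2 : ‖v.op (φ n)‖ ^ 2 = 0 := by
        rw [← inner_self_eq_norm_sq (𝕜 := ℂ)]; exact h1
      simpa using h2

instance : NormedAddCommGroup (JordanHS φ) := (innerCore φ).toNormedAddCommGroup

instance : InnerProductSpace ℝ (JordanHS φ) := InnerProductSpace.ofCore (innerCore φ).toCore

end JordanHS

/-! ## Jordan multiplication and the Jordan–Schrödinger equation -/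

variable (φ : HilbertBasis ℕ ℂ E)

/-- The graph of Jordan multiplication by the symmetric operator `R`: the pairs `(v, w)` with
`w = (R v + v R) / 2`, tested against finite combinations of number states. -/
def jordanMulGraph (R : Module.End ℂ (FockSpan φ)) : Submodule ℝ (JordanHS φ × JordanHS φ) where
  carrier := {p | ∀ x y : FockSpan φ,
    ⟪(x : E), p.2.op y⟫_ℂ =
      (1 / 2 : ℂ) * (⟪((R x : FockSpan φ) : E), p.1.op y⟫_ℂ + ⟪(x : E), p.1.op (R y)⟫_ℂ)}
  zero_mem' := by
    intro x y
    simp [JordanHS.op_zero]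
  add_mem' := by
    intro p q hp hq x y
    have h1 := hp x y
    have h2 := hq x y
    simp only [Prod.fst_add, Prod.snd_add, JordanHS.op_add, add_apply, inner_add_right]
    rw [h1, h2]; ring
  smul_mem' := by
    intro c p hp x y
    have h1 := hp x y
    simp only [Prod.smul_fst, Prod.smul_snd, JordanHS.op_smul, smul_apply]
    simp only [← Complex.coe_smul, inner_smul_right]
    rw [h1]; ring

theorem jordanMulGraph_functional (R : Module.End ℂ (FockSpan φ)) (p : JordanHS φ × JordanHS φ)
    (hp : p ∈ jordanMulGraph φ R) (h0 : p.1 = 0) : p.2 = 0 := by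
  have hd : Dense ((FockSpan φ : Submodule ℂ E) : Set E) := by
    rw [Submodule.dense_iff_topologicalClosure_eq_top]; exact φ.dense_span
  apply JordanHS.op_injective
  rw [JordanHS.op_zero]
  refine ContinuousLinearMap.ext_on (s := Set.range φ) hd ?_
  rintro _ ⟨n, rfl⟩
  have key : ∀ x ∈ ((FockSpan φ : Submodule ℂ E) : Set E), ⟪x, p.2.op (φ n)⟫_ℂ = 0 := by
    intro x hx
    have h := hp ⟨x, hx⟩ ⟨φ n, Submodule.subset_span ⟨n, rfl⟩⟩
    simpa [h0, JordanHS.op_zero] using h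
  simpa using hd.eq_zero_of_inner_right (𝕜 := ℂ) fun x hx => key x hx

/-- Jordan multiplication `L_R v = R • v = (R v + v R) / 2`, as an unbounded operator on
`JordanHS φ` with its maximal domain. -/
def jordanL (R : Module.End ℂ (FockSpan φ)) : JordanHS φ →ₗ.[ℝ] JordanHS φ :=
  (jordanMulGraph φ R).toLinearPMap

/-- `K = [L_{S₁}, L_{R₁}] + [L_{S₂}, L_{R₂}]`, on its natural domain. -/
def jordanK (ħ m Ω : ℝ) : JordanHS φ →ₗ.[ℝ] JordanHS φ :=
  pcommutator (jordanL φ (opS1 φ ħ m Ω)) (jordanL φ (opR1 φ ħ m Ω)) +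
    pcommutator (jordanL φ (opS2 φ)) (jordanL φ (opR2 φ ħ m Ω))

/-- The Jordan exponential `exp (-(4 t / ħ) K)`, with `K` replaced by its closure. -/
def jordanEvolution (ħ m Ω : ℝ) : ℝ → JordanHS φ →L[ℝ] JordanHS φ :=
  opExp ((-(4 / ħ)) • (jordanK φ ħ m Ω).closure)

end JordanHilbert

section Composite

variable {Ep Em : Type*} [NormedAddCommGroup Ep] [InnerProductSpace ℂ Ep] [CompleteSpace Ep]
  [NormedAddCommGroup Em] [InnerProductSpace ℂ Em] [CompleteSpace Em]

/-- The Hilbert tensor product of the real Hilbert spaces of the two subsystems. -/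
abbrev CompositeHS (φp : HilbertBasis ℕ ℂ Ep) (φm : HilbertBasis ℕ ℂ Em) : Type _ :=
  UniformSpace.Completion (JordanHS φp ⊗[ℝ] JordanHS φm)

/-- The elementary tensor `v ⊗ w` in the Hilbert tensor product. -/
def stateTensor {φp : HilbertBasis ℕ ℂ Ep} {φm : HilbertBasis ℕ ℂ Em}
    (v : JordanHS φp) (w : JordanHS φm) : CompositeHS φp φm :=
  ((v ⊗ₜ[ℝ] w : JordanHS φp ⊗[ℝ] JordanHS φm) : UniformSpace.Completion _)

/-- The curve `t ↦ v t ⊗ w t` solves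
`d/dt (v ⊗ w) = -(4/ħ) ((Kp v) ⊗ w + v ⊗ (Km w))`. -/
structure SolvesJordanSchrodinger {φp : HilbertBasis ℕ ℂ Ep} {φm : HilbertBasis ℕ ℂ Em} (ħ : ℝ)
    (Kp : JordanHS φp →ₗ.[ℝ] JordanHS φp) (Km : JordanHS φm →ₗ.[ℝ] JordanHS φm)
    (v : ℝ → JordanHS φp) (w : ℝ → JordanHS φm) : Prop where
  mem_left : ∀ t, v t ∈ Kp.domain
  mem_right : ∀ t, w t ∈ Km.domain
  hasDerivAt : ∀ t, HasDerivAt (fun s => stateTensor (v s) (w s))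
    ((-(4 / ħ)) • (stateTensor (Kp ⟨v t, mem_left t⟩) (w t) +
      stateTensor (v t) (Km ⟨w t, mem_right t⟩))) t

/-- The operator `a ⊗ b` on the (dense) algebraic tensor product of the two Hilbert spaces. -/
abbrev opTensor (a : Ep →L[ℂ] Ep) (b : Em →L[ℂ] Em) : Ep ⊗[ℂ] Em →L[ℂ] Ep ⊗[ℂ] Em :=
  TensorProduct.mapL a b

end Composite

end

open scoped TensorProduct InnerProductSpace

noncomputable section

section DiagonalGroups

open Filter Topology

/-- Complex coordinates on a real normed space whose square sum is the squared norm, together with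
truncation operators onto an exhausting sequence of finite sets of indices. -/
structure CoordFrame (V : Type*) [NormedAddCommGroup V] [NormedSpace ℝ V] (ι : Type*) where
  coord : ι → V →L[ℝ] ℂ
  hasSum_sq : ∀ x, HasSum (fun i => ‖coord i x‖ ^ 2) (‖x‖ ^ 2)
  box : ℕ → Finset ι
  tendsto_box : Tendsto box atTop atTop
  trunc : ℕ → V → V
  coord_trunc_mem : ∀ N x, ∀ i ∈ box N, coord i (trunc N x) = coord i x
  coord_trunc_notMem : ∀ N x, ∀ i ∉ box N, coord i (trunc N x) = 0

namespace CoordFrame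

variable {V : Type*} [NormedAddCommGroup V] [NormedSpace ℝ V] {ι : Type*} (F : CoordFrame V ι)

include F in
theorem ext {x y : V} (h : ∀ i, F.coord i x = F.coord i y) : x = y := by
  have h1 := F.hasSum_sq (x - y)
  have h2 : (fun i => ‖F.coord i (x - y)‖ ^ 2) = fun _ => (0 : ℝ) := by
    ext i; simp [h i]
  rw [h2] at h1
  have h3 := h1.unique hasSum_zero
  exact sub_eq_zero.1 (by simpa using h3)

theorem norm_eq_of_coord {x y : V} (h : ∀ i, ‖F.coord i x‖ = ‖F.coord i y‖) : ‖x‖ = ‖y‖ := by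
  have h1 := F.hasSum_sq x
  simp only [h] at h1
  exact (sq_eq_sq₀ (norm_nonneg _) (norm_nonneg _)).1 (h1.unique (F.hasSum_sq y))

theorem norm_le_sum {x : V} (s : Finset ι) (h : ∀ i ∉ s, F.coord i x = 0) :
    ‖x‖ ≤ ∑ i ∈ s, ‖F.coord i x‖ := by
  have h1 : ‖x‖ ^ 2 = ∑ i ∈ s, ‖F.coord i x‖ ^ 2 :=
    (F.hasSum_sq x).unique (hasSum_sum_of_ne_finset_zero fun i hi => by simp [h i hi])
  refine le_of_sq_le_sq ?_ (Finset.sum_nonneg fun i _ => norm_nonneg _)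
  rw [h1]
  exact Finset.sum_sq_le_sq_sum_of_nonneg fun i _ => norm_nonneg _

theorem tendsto_trunc (x : V) : Tendsto (fun N => F.trunc N x) atTop (𝓝 x) := by
  have key : ∀ N, ‖F.trunc N x - x‖ ^ 2 = ‖x‖ ^ 2 - ∑ i ∈ F.box N, ‖F.coord i x‖ ^ 2 := by
    intro N
    have h1 := F.hasSum_sq (F.trunc N x - x)
    have h2 : HasSum (fun i => ‖F.coord i (F.trunc N x)‖ ^ 2)
        (∑ i ∈ F.box N, ‖F.coord i x‖ ^ 2) := by
      have : HasSum (fun i => ‖F.coord i (F.trunc N x)‖ ^ 2)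
          (∑ i ∈ F.box N, ‖F.coord i (F.trunc N x)‖ ^ 2) :=
        hasSum_sum_of_ne_finset_zero fun i hi => by simp [F.coord_trunc_notMem N x i hi]
      rwa [Finset.sum_congr rfl fun i hi => by rw [F.coord_trunc_mem N x i hi]] at this
    have h3 := (F.hasSum_sq x).sub h2
    suffices h4 : (fun i => ‖F.coord i (F.trunc N x - x)‖ ^ 2) =
        fun i => ‖F.coord i x‖ ^ 2 - ‖F.coord i (F.trunc N x)‖ ^ 2 by
      rw [h4] at h1
      exact h1.unique h3
    ext i
    by_cases hi : i ∈ F.box N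
    · simp [F.coord_trunc_mem N x i hi]
    · simp [F.coord_trunc_notMem N x i hi]
  rw [tendsto_iff_norm_sub_tendsto_zero]
  have h4 : Tendsto (fun N => ‖x‖ ^ 2 - ∑ i ∈ F.box N, ‖F.coord i x‖ ^ 2) atTop (𝓝 0) := by
    have := ((F.hasSum_sq x).comp F.tendsto_box).const_sub (‖x‖ ^ 2)
    simpa using this
  have h5 := h4.sqrt
  simp only [← key, Real.sqrt_sq (norm_nonneg _), Real.sqrt_zero] at h5
  exact h5

section Closure

variable {𝕜 : Type*} [RCLike 𝕜] [NormedSpace 𝕜 V] {G : V →ₗ.[𝕜] V} {μ : ι → ℂ}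

theorem mem_closure_graph_iff
    (hG : ∀ x : G.domain, ∀ i, F.coord i (G x) = μ i * F.coord i x)
    (hdom : ∀ N x, F.trunc N x ∈ G.domain) (p : V × V) :
    p ∈ G.graph.topologicalClosure ↔ ∀ i, F.coord i p.2 = μ i * F.coord i p.1 := by
  constructor
  · intro hp i
    have hcl : IsClosed {q : V × V | F.coord i q.2 = μ i * F.coord i q.1} :=
      isClosed_eq (by fun_prop) (by fun_prop)
    refine hcl.closure_subset_iff.2 ?_ hp
    rintro ⟨x, y⟩ hxy
    obtain ⟨z, rfl, rfl⟩ := (LinearPMap.mem_graph_iff _).1 hxy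
    exact hG z i
  · intro h
    have hlim : Tendsto (fun N => (F.trunc N p.1, F.trunc N p.2)) atTop (𝓝 p) :=
      (F.tendsto_trunc p.1).prodMk_nhds (F.tendsto_trunc p.2)
    refine mem_closure_of_tendsto hlim (Eventually.of_forall fun N => ?_)
    have : F.trunc N p.2 = G ⟨F.trunc N p.1, hdom N p.1⟩ := by
      refine F.ext fun i => ?_
      rw [hG]
      by_cases hi : i ∈ F.box N
      · simp [F.coord_trunc_mem N _ i hi, h i]
      · simp [F.coord_trunc_notMem N _ i hi]
    rw [this]
    exact G.mem_graph ⟨F.trunc N p.1, hdom N p.1⟩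

theorem isClosable
    (hG : ∀ x : G.domain, ∀ i, F.coord i (G x) = μ i * F.coord i x)
    (hdom : ∀ N x, F.trunc N x ∈ G.domain) : G.IsClosable := by
  refine ⟨G.graph.topologicalClosure.toLinearPMap,
    (Submodule.toLinearPMap_graph_eq _ fun p hp h0 => ?_).symm⟩
  refine F.ext fun i => ?_
  rw [(F.mem_closure_graph_iff hG hdom p).1 hp i, h0]
  simp

theorem mem_graph_closure_iff
    (hG : ∀ x : G.domain, ∀ i, F.coord i (G x) = μ i * F.coord i x)
    (hdom : ∀ N x, F.trunc N x ∈ G.domain) (x y : V) :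
    (x, y) ∈ G.closure.graph ↔ ∀ i, F.coord i y = μ i * F.coord i x := by
  rw [← (F.isClosable hG hdom).graph_closure_eq_closure_graph, F.mem_closure_graph_iff hG hdom]

end Closure

section Group

variable {T : ℝ → V → V} {l : ι → ℝ}

theorem norm_phase_sub
    (hT : ∀ t x i, F.coord i (T t x) = Complex.exp (t * l i * Complex.I) * F.coord i x)
    (t : ℝ) (x y : V) : ‖T t x - T t y‖ = ‖x - y‖ := by
  refine F.norm_eq_of_coord fun i => ?_
  rw [map_sub, map_sub, hT, hT, ← mul_sub, norm_mul, ← Complex.ofReal_mul,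
    Complex.norm_exp_ofReal_mul_I, one_mul]

theorem phase_add
    (hT : ∀ t x i, F.coord i (T t x) = Complex.exp (t * l i * Complex.I) * F.coord i x)
    (s t : ℝ) (x : V) : T (s + t) x = T s (T t x) := by
  refine F.ext fun i => ?_
  rw [hT, hT, hT, ← mul_assoc, ← Complex.exp_add]
  push_cast
  ring_nf

theorem phase_zero
    (hT : ∀ t x i, F.coord i (T t x) = Complex.exp (t * l i * Complex.I) * F.coord i x)
    (x : V) : T 0 x = x := by
  refine F.ext fun i => ?_
  rw [hT]
  simp

theorem hasDerivAt_exp_phase (a t : ℝ) (z : ℂ) :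
    HasDerivAt (fun s : ℝ => Complex.exp (s * a * Complex.I) * z)
      (Complex.exp (t * a * Complex.I) * (a * Complex.I * z)) t := by
  have h1 : HasDerivAt (fun s : ℝ => (s : ℂ) * a * Complex.I) (a * Complex.I) t := by
    have := ((Complex.ofRealCLM.hasDerivAt (x := t)).mul_const (a : ℂ)).mul_const Complex.I
    simpa using this
  have := h1.cexp.mul_const z
  rwa [mul_assoc] at this

/-- Differentiability of the orbit of a vector with finitely many coordinates. -/
theorem hasDerivAt_phase_of_finite
    (hT : ∀ t x i, F.coord i (T t x) = Complex.exp (t * l i * Complex.I) * F.coord i x)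
    {x y : V} (s : Finset ι) (hx : ∀ i ∉ s, F.coord i x = 0)
    (hxy : ∀ i, F.coord i y = l i * Complex.I * F.coord i x) (t : ℝ) :
    HasDerivAt (fun r => T r x) (T t y) t := by
  rw [hasDerivAt_iff_isLittleO]
  have h1 : ∀ i, (fun r : ℝ => F.coord i (T r x - T t x - (r - t) • T t y)) =o[𝓝 t]
      fun r => r - t := by
    intro i
    have h2 := (hasDerivAt_exp_phase (l i) t (F.coord i x)).isLittleO
    refine h2.congr_left fun r => ?_
    simp only [map_sub, map_smul, hT, hxy]
  have h3 : (fun r : ℝ => ∑ i ∈ s, ‖F.coord i (T r x - T t x - (r - t) • T t y)‖) =o[𝓝 t]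
      fun r => r - t := by
    have h := Asymptotics.IsLittleO.sum fun i (_ : i ∈ s) => (h1 i).norm_left
    rwa [Finset.sum_fn] at h
  refine Asymptotics.IsBigO.trans_isLittleO (Asymptotics.IsBigO.of_bound 1 ?_) h3
  refine Eventually.of_forall fun r => ?_
  rw [one_mul, Real.norm_of_nonneg (Finset.sum_nonneg fun i _ => norm_nonneg _)]
  refine F.norm_le_sum s fun i hi => ?_
  simp [hT, hxy, hx i hi]

theorem tendstoUniformly_phase_trunc
    (hT : ∀ t x i, F.coord i (T t x) = Complex.exp (t * l i * Complex.I) * F.coord i x) (x : V) :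
    TendstoUniformly (fun N t => T t (F.trunc N x)) (fun t => T t x) atTop := by
  rw [Metric.tendstoUniformly_iff]
  intro ε hε
  filter_upwards [(Metric.tendsto_nhds.1 (F.tendsto_trunc x)) ε hε] with N hN t
  rwa [dist_comm, dist_eq_norm, F.norm_phase_sub hT, ← dist_eq_norm]

theorem hasDerivAt_phase
    (hT : ∀ t x i, F.coord i (T t x) = Complex.exp (t * l i * Complex.I) * F.coord i x)
    {x y : V} (hxy : ∀ i, F.coord i y = l i * Complex.I * F.coord i x) (t : ℝ) :
    HasDerivAt (fun r => T r x) (T t y) t := by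
  refine hasDerivAt_of_tendstoUniformly (F.tendstoUniformly_phase_trunc hT y)
    (Eventually.of_forall fun N s => F.hasDerivAt_phase_of_finite hT (F.box N) (x := F.trunc N x)
      (F.coord_trunc_notMem N x) (fun i => ?_) s)
    (fun s => (F.tendstoUniformly_phase_trunc hT x).tendsto_at s) t
  by_cases hi : i ∈ F.box N
  · simp [F.coord_trunc_mem N _ i hi, hxy]
  · simp [F.coord_trunc_notMem N _ i hi]

theorem continuous_phase
    (hT : ∀ t x i, F.coord i (T t x) = Complex.exp (t * l i * Complex.I) * F.coord i x)
    (htr : ∀ N x, ∃ y, ∀ i, F.coord i y = l i * Complex.I * F.coord i (F.trunc N x)) (x : V) :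
    Continuous fun t => T t x := by
  refine (F.tendstoUniformly_phase_trunc hT x).continuous (Frequently.of_forall fun N => ?_)
  obtain ⟨y, hy⟩ := htr N x
  exact continuous_iff_continuousAt.2 fun t => (F.hasDerivAt_phase hT hy t).continuousAt

theorem coord_eq_of_hasDerivAt
    (hT : ∀ t x i, F.coord i (T t x) = Complex.exp (t * l i * Complex.I) * F.coord i x)
    {x y : V} (h : HasDerivAt (fun r => T r x) y 0) (i : ι) :
    F.coord i y = l i * Complex.I * F.coord i x := by
  have h1 : HasDerivAt (fun r => F.coord i (T r x)) (F.coord i y) 0 :=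
    (F.coord i).hasFDerivAt.comp_hasDerivAt (0 : ℝ) h
  simp only [hT] at h1
  have h2 := h1.unique (hasDerivAt_exp_phase (l i) 0 (F.coord i x))
  simpa using h2

end Group

section Generator

variable {𝕜 : Type*} [RCLike 𝕜] [NormedSpace 𝕜 V] {G : V →ₗ.[𝕜] V} {l : ι → ℝ}
  {T : ℝ → V →L[𝕜] V}

theorem isOpExp
    (hG : ∀ x y, (x, y) ∈ G.graph ↔ ∀ i, F.coord i y = l i * Complex.I * F.coord i x)
    (htr : ∀ N x, F.trunc N x ∈ G.domain)
    (hT : ∀ t x i, F.coord i (T t x) = Complex.exp (t * l i * Complex.I) * F.coord i x) :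
    IsOpExp G T where
  map_zero := ContinuousLinearMap.ext fun x => F.phase_zero (T := fun t x => T t x) hT x
  map_add s t := ContinuousLinearMap.ext fun x => F.phase_add (T := fun t x => T t x) hT s t x
  continuous x := F.continuous_phase (T := fun t x => T t x) hT
    (fun N x => ⟨G ⟨F.trunc N x, htr N x⟩, (hG _ _).1 (G.mem_graph ⟨F.trunc N x, htr N x⟩)⟩) x
  generator x y := by
    rw [hG]
    refine ⟨fun h i => F.coord_eq_of_hasDerivAt (T := fun t x => T t x) hT h i, fun h => ?_⟩
    have := F.hasDerivAt_phase (T := fun t x => T t x) hT h 0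
    rwa [F.phase_zero (T := fun t x => T t x) hT] at this

end Generator

end CoordFrame

theorem mem_graph_smul_iff {𝕜 V : Type*} [Field 𝕜] [AddCommGroup V] [Module 𝕜 V]
    {G : V →ₗ.[𝕜] V} {a : 𝕜} (ha : a ≠ 0) {x y : V} :
    (x, y) ∈ (a • G).graph ↔ (x, a⁻¹ • y) ∈ G.graph := by
  simp only [LinearPMap.smul_graph, Submodule.mem_map, Prod.exists, LinearMap.prodMap_apply,
    LinearMap.id_apply, LinearMap.smul_apply, Prod.mk.injEq]
  constructor
  · rintro ⟨u, v, h, rfl, rfl⟩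
    rwa [inv_smul_smul₀ ha]
  · exact fun h => ⟨_, _, h, rfl, smul_inv_smul₀ ha y⟩

section OpExp

variable {V : Type*} [NormedAddCommGroup V] [NormedSpace ℝ V]
  {𝕜 : Type*} [RCLike 𝕜] [NormedSpace 𝕜 V] {G : V →ₗ.[𝕜] V} {T : ℝ → V →L[𝕜] V}

namespace IsOpExp

/-- An orbit starting in the domain of the generator is differentiable and stays in the domain. -/
theorem mem_graph (hT : IsOpExp G T) {x y : V} (h : (x, y) ∈ G.graph) (t : ℝ) :
    (T t x, T t y) ∈ G.graph := by
  rw [← hT.generator]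
  have h1 : HasDerivAt (fun r => T t (T r x)) (T t y) 0 :=
    ((T t : V →+ V).toRealLinearMap (T t).continuous).hasFDerivAt.comp_hasDerivAt (0 : ℝ)
      ((hT.generator x y).2 h)
  refine h1.congr_deriv rfl |>.congr_of_eventuallyEq (Eventually.of_forall fun r => ?_)
  change T r (T t x) = T t (T r x)
  rw [← mul_apply_eq_comp, ← mul_apply_eq_comp, ← hT.map_add, ← hT.map_add, add_comm]

theorem hasDerivAt (hT : IsOpExp G T) {x y : V} (h : (x, y) ∈ G.graph) (t : ℝ) :
    HasDerivAt (fun r => T r x) (T t y) t := by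
  have h1 : HasDerivAt (fun r => T r (T t x)) (T t y) (t - t) := by
    rw [sub_self, hT.generator]
    exact hT.mem_graph h t
  have h2 := h1.comp_sub_const t t
  refine h2.congr_of_eventuallyEq (Eventually.of_forall fun r => ?_)
  change T r x = T (r - t) (T t x)
  rw [← mul_apply_eq_comp, ← hT.map_add, sub_add_cancel]

end IsOpExp

theorem opExp_eq (hT : IsOpExp G T) (huniq : ∀ S, IsOpExp G S → S = T) : opExp G = T := by
  have h : ∃ T : ℝ → V →L[𝕜] V, IsOpExp G T := ⟨T, hT⟩
  rw [opExp, dif_pos h]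
  exact huniq _ h.choose_spec

theorem CoordFrame.isOpExp_unique {ι : Type*} (F : CoordFrame V ι) {l : ι → ℝ}
    (hG : ∀ x y, (x, y) ∈ G.graph ↔ ∀ i, F.coord i y = l i * Complex.I * F.coord i x)
    (htr : ∀ N x, F.trunc N x ∈ G.domain)
    (hT : ∀ t x i, F.coord i (T t x) = Complex.exp (t * l i * Complex.I) * F.coord i x)
    {S : ℝ → V →L[𝕜] V} (hS : IsOpExp G S) : S = T := by
  have hdom : ∀ x ∈ G.domain, ∀ t, S t x = T t x := by
    intro x hx t
    refine F.ext fun i => ?_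
    have hxy := G.mem_graph ⟨x, hx⟩
    have h1 : ∀ t, HasDerivAt (fun r : ℝ => Complex.exp (r * (-l i) * Complex.I) *
        F.coord i (S r x)) 0 t := by
      intro t
      have h2 : HasDerivAt (fun r => F.coord i (S r x))
          (l i * Complex.I * F.coord i (S t x)) t := by
        rw [← (hG _ _).1 (hS.mem_graph hxy t) i]
        exact (F.coord i).hasFDerivAt.comp_hasDerivAt t (hS.hasDerivAt hxy t)
      have h3 := hasDerivAt_exp_phase (-l i) t 1
      simp only [mul_one, Complex.ofReal_neg] at h3
      refine (h3.mul h2).congr_deriv ?_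
      ring
    have h4 := is_const_of_deriv_eq_zero (fun t => (h1 t).differentiableAt)
      (fun t => (h1 t).deriv) t 0
    have h5 : S 0 x = x := by rw [hS.map_zero]; rfl
    simp only [h5, Complex.ofReal_zero, zero_mul, Complex.exp_zero, one_mul] at h4
    rw [hT, ← h4, ← mul_assoc, ← Complex.exp_add]
    simp
  funext t
  refine ContinuousLinearMap.ext fun x => ?_
  exact tendsto_nhds_unique (((S t).continuous.tendsto x).comp (F.tendsto_trunc x))
    ((((T t).continuous.tendsto x).comp (F.tendsto_trunc x)).congr
      fun N => (hdom _ (htr N x) t).symm)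

end OpExp
end DiagonalGroups

section FockSpace

variable {E : Type*} [NormedAddCommGroup E] [InnerProductSpace ℂ E] (φ : HilbertBasis ℕ ℂ E)

section Algebra

theorem numberBasis_coe (n : ℕ) : (numberBasis φ n : E) = φ n :=
  congrArg Subtype.val (Module.Basis.span_apply φ.orthonormal.linearIndependent n)

@[elab_as_elim]
theorem fockSpan_induction {p : FockSpan φ → Prop} (zero : p 0)
    (add : ∀ x y, p x → p y → p (x + y)) (smul : ∀ (c : ℂ) x, p x → p (c • x))
    (basis : ∀ n, p (numberBasis φ n)) (x : FockSpan φ) : p x := by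
  have hx : x ∈ Submodule.span ℂ (Set.range (numberBasis φ)) := by
    rw [(numberBasis φ).span_eq]
    trivial
  induction hx using Submodule.span_induction with
  | mem y hy =>
    obtain ⟨n, rfl⟩ := hy
    exact basis n
  | zero => exact zero
  | add y z _ _ hy hz => exact add y z hy hz
  | smul c y _ hy => exact smul c y hy

theorem annih_numberBasis (n : ℕ) :
    annih φ (numberBasis φ n) = ((Real.sqrt n : ℝ) : ℂ) • numberBasis φ (n - 1) :=
  Module.Basis.constr_basis _ _ _ _

theorem creat_numberBasis (n : ℕ) :
    creat φ (numberBasis φ n) = ((Real.sqrt (n + 1) : ℝ) : ℂ) • numberBasis φ (n + 1) :=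
  Module.Basis.constr_basis _ _ _ _

theorem creat_annih_numberBasis (n : ℕ) :
    creat φ (annih φ (numberBasis φ n)) = (n : ℂ) • numberBasis φ n := by
  rw [annih_numberBasis, map_smul, creat_numberBasis, smul_smul]
  rcases n with _ | n
  · simp
  · rw [Nat.add_sub_cancel, ← Complex.ofReal_mul, Nat.cast_succ,
      Real.mul_self_sqrt (by positivity)]
    push_cast
    rfl

theorem annih_mul_creat : annih φ * creat φ = creat φ * annih φ + 1 := by
  refine (numberBasis φ).ext fun n => ?_
  simp only [LinearMap.add_apply, Module.End.mul_apply, Module.End.one_apply]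
  rw [creat_annih_numberBasis, creat_numberBasis, map_smul, annih_numberBasis, smul_smul,
    Nat.add_sub_cancel, ← Complex.ofReal_mul, Nat.cast_succ, Real.mul_self_sqrt (by positivity)]
  push_cast
  rw [add_smul, one_smul]

theorem hamiltonian_numberBasis (ħ Ω : ℝ) (n : ℕ) :
    hamiltonian φ ħ Ω (numberBasis φ n) = ((ħ * Ω * (n + 1 / 2) : ℝ) : ℂ) • numberBasis φ n := by
  simp only [hamiltonian, LinearMap.smul_apply, LinearMap.add_apply, Module.End.mul_apply,
    Module.End.one_apply, creat_annih_numberBasis]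
  push_cast
  module

theorem constC1_mul_constC2 {ħ m Ω : ℝ} (hħ : 0 < ħ) (hm : 0 < m) (hΩ : 0 < Ω) :
    constC1 ħ m Ω * constC2 ħ m Ω = ħ / 2 := by
  rw [constC1, constC2, ← Real.sqrt_mul (by positivity),
    show ħ / (2 * m * Ω) * (ħ * m * Ω / 2) = (ħ / 2) ^ 2 by field_simp,
    Real.sqrt_sq (by positivity)]

theorem hamiltonian_eq_commutators {ħ m Ω : ℝ} (hħ : 0 < ħ) (hm : 0 < m) (hΩ : 0 < Ω) :
    hamiltonian φ ħ Ω =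
      Complex.I • ⁅opR1 φ ħ m Ω, opS1 φ ħ m Ω⁆ + Complex.I • ⁅opR2 φ ħ m Ω, opS2 φ⁆ := by
  have hc : (constC1 ħ m Ω : ℂ) * constC2 ħ m Ω = ħ / 2 := by
    rw [← Complex.ofReal_mul, constC1_mul_constC2 hħ hm hΩ]; push_cast; rfl
  have h1 := annih_mul_creat φ
  have h2 : ∀ Z, annih φ * (creat φ * Z) = creat φ * (annih φ * Z) + Z := fun Z => by
    rw [← mul_assoc, h1, add_mul, one_mul, mul_assoc]
  have hR1 : opR1 φ ħ m Ω = (-(Ω : ℂ) / 4 * constC1 ħ m Ω) •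
      (creat φ * creat φ + annih φ * annih φ + (2 : ℂ) • (creat φ * annih φ)) := by
    simp only [opR1, posOp, smul_mul_assoc, mul_smul_comm, add_mul, mul_add]
    module
  have hS1 : opS1 φ ħ m Ω = (Complex.I * constC2 ħ m Ω) •
      (creat φ * creat φ - annih φ * annih φ) := by
    simp only [opS1, momOp, smul_mul_assoc, mul_smul_comm, sub_mul, mul_sub]
    module
  have hR2 : opR2 φ ħ m Ω = (-(Ω : ℂ) / 2 * constC1 ħ m Ω) • opS1 φ ħ m Ω := by
    simp only [opR2, opS1]
    module
  have hc1 : ⁅creat φ * creat φ + annih φ * annih φ + (2 : ℂ) • (creat φ * annih φ),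
      creat φ * creat φ - annih φ * annih φ⁆ =
      (8 : ℂ) • (creat φ * annih φ) + (4 : ℂ) • (1 : Module.End ℂ (FockSpan φ)) +
        (4 : ℂ) • (creat φ * creat φ + annih φ * annih φ) := by
    simp only [Ring.lie_def, mul_add, add_mul, mul_sub, sub_mul, smul_mul_assoc, mul_smul_comm,
      mul_assoc, h1, h2, mul_one]
    module
  have hc2 : ⁅creat φ * creat φ - annih φ * annih φ, creat φ * annih φ⁆ =
      (-2 : ℂ) • (creat φ * creat φ + annih φ * annih φ) := by
    simp only [Ring.lie_def, mul_add, mul_sub, sub_mul, mul_assoc, h1, h2]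
    module
  rw [hR2, hS1, smul_smul, hR1, opS2]
  have hl : ∀ (a b : ℂ) (X Y : Module.End ℂ (FockSpan φ)), ⁅a • X, b • Y⁆ = (a * b) • ⁅X, Y⁆ := by
    intro a b X Y
    simp only [Ring.lie_def, smul_mul_smul_comm, smul_sub, mul_comm b a]
  have hl' : ∀ (a : ℂ) (X Y : Module.End ℂ (FockSpan φ)), ⁅a • X, Y⁆ = a • ⁅X, Y⁆ := by
    intro a X Y
    simpa using hl a 1 X Y
  rw [hl, hl', hc1, hc2, hamiltonian]
  have e1 : Complex.I * (-(Ω : ℂ) / 4 * constC1 ħ m Ω * (Complex.I * constC2 ħ m Ω)) =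
      ħ * Ω / 8 := by
    linear_combination (Ω : ℂ) / 4 * hc - (Ω : ℂ) / 4 * (constC1 ħ m Ω * constC2 ħ m Ω) *
      Complex.I_mul_I
  have e2 : Complex.I * (-(Ω : ℂ) / 2 * constC1 ħ m Ω * (Complex.I * constC2 ħ m Ω)) =
      ħ * Ω / 4 := by
    linear_combination (Ω : ℂ) / 2 * hc - (Ω : ℂ) / 2 * (constC1 ħ m Ω * constC2 ħ m Ω) *
      Complex.I_mul_I
  simp only [smul_smul Complex.I, e1, e2]
  push_cast
  module

end Algebra

section Symmetric

/-- `R` and `S` are formal adjoints of each other on the span of the number states. -/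
def FormalAdjoint (R S : Module.End ℂ (FockSpan φ)) : Prop :=
  ∀ x y : FockSpan φ, ⟪R x, y⟫_ℂ = ⟪x, S y⟫_ℂ

variable {φ}

theorem FormalAdjoint.symm {R S : Module.End ℂ (FockSpan φ)} (h : FormalAdjoint φ R S) :
    FormalAdjoint φ S R := fun x y => by
  rw [← inner_conj_symm, ← h, inner_conj_symm]

theorem FormalAdjoint.add {R S R' S' : Module.End ℂ (FockSpan φ)} (h : FormalAdjoint φ R S)
    (h' : FormalAdjoint φ R' S') : FormalAdjoint φ (R + R') (S + S') := fun x y => by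
  simp only [LinearMap.add_apply, inner_add_left, inner_add_right, h x y, h' x y]

theorem FormalAdjoint.sub {R S R' S' : Module.End ℂ (FockSpan φ)} (h : FormalAdjoint φ R S)
    (h' : FormalAdjoint φ R' S') : FormalAdjoint φ (R - R') (S - S') := fun x y => by
  simp only [LinearMap.sub_apply, inner_sub_left, inner_sub_right, h x y, h' x y]

theorem FormalAdjoint.mul {R S R' S' : Module.End ℂ (FockSpan φ)} (h : FormalAdjoint φ R S)
    (h' : FormalAdjoint φ R' S') : FormalAdjoint φ (R * R') (S' * S) := fun x y => by
  simp only [Module.End.mul_apply, h _ _, h' _ _]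

theorem FormalAdjoint.smul {R S : Module.End ℂ (FockSpan φ)} (h : FormalAdjoint φ R S)
    {a b : ℂ} (hab : starRingEnd ℂ a = b) : FormalAdjoint φ (a • R) (b • S) := fun x y => by
  simp only [LinearMap.smul_apply, inner_smul_left, inner_smul_right, h x y, hab]

variable (φ)

theorem formalAdjoint_creat_annih : FormalAdjoint φ (creat φ) (annih φ) := by
  have hb : ∀ j k : ℕ, ⟪creat φ (numberBasis φ j), numberBasis φ k⟫_ℂ =
      ⟪numberBasis φ j, annih φ (numberBasis φ k)⟫_ℂ := by
    intro j k
    rw [creat_numberBasis, annih_numberBasis, inner_smul_left, inner_smul_right]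
    simp only [Submodule.coe_inner, numberBasis_coe, orthonormal_iff_ite.1 φ.orthonormal]
    rcases k with _ | k
    · simp
    · by_cases h : j = k <;> simp [h]
  intro x y
  induction x using fockSpan_induction φ with
  | zero => simp
  | add x x' hx hx' => simp [hx, hx']
  | smul c x hx => simp [hx]
  | basis j =>
    induction y using fockSpan_induction φ with
    | zero => simp
    | add x x' hx hx' => simp [hx, hx']
    | smul c x hx => simp [hx]
    | basis k => exact hb j k

theorem formalAdjoint_posOp (ħ m Ω : ℝ) : FormalAdjoint φ (posOp φ ħ m Ω) (posOp φ ħ m Ω) := by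
  have h := formalAdjoint_creat_annih φ
  have h1 := (h.add h.symm).smul (Complex.conj_ofReal (constC1 ħ m Ω))
  rwa [add_comm (annih φ)] at h1

theorem formalAdjoint_momOp (ħ m Ω : ℝ) : FormalAdjoint φ (momOp φ ħ m Ω) (momOp φ ħ m Ω) := by
  have h := formalAdjoint_creat_annih φ
  have h1 := (h.sub h.symm).smul (a := Complex.I * (constC2 ħ m Ω : ℂ)) rfl
  have h2 : (starRingEnd ℂ) (Complex.I * (constC2 ħ m Ω : ℂ)) • (annih φ - creat φ) =
      momOp φ ħ m Ω := by
    simp only [momOp, map_mul, Complex.conj_I, Complex.conj_ofReal]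
    module
  rwa [h2] at h1

theorem formalAdjoint_opS1 (ħ m Ω : ℝ) : FormalAdjoint φ (opS1 φ ħ m Ω) (opS1 φ ħ m Ω) := by
  have h := formalAdjoint_creat_annih φ
  have hp := formalAdjoint_momOp φ ħ m Ω
  have h1 := (hp.mul h.symm).add (h.mul hp)
  rwa [add_comm (creat φ * _)] at h1

theorem formalAdjoint_opS2 : FormalAdjoint φ (opS2 φ) (opS2 φ) :=
  (formalAdjoint_creat_annih φ).mul (formalAdjoint_creat_annih φ).symm

theorem formalAdjoint_opR1 (ħ m Ω : ℝ) : FormalAdjoint φ (opR1 φ ħ m Ω) (opR1 φ ħ m Ω) := by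
  have h := formalAdjoint_creat_annih φ
  have hp := formalAdjoint_posOp φ ħ m Ω
  have h1 := ((hp.mul h.symm).add (h.mul hp)).smul (a := -(Ω : ℂ) / 4) (b := -(Ω : ℂ) / 4)
    (by rw [map_div₀, map_neg, Complex.conj_ofReal, Complex.conj_ofNat])
  rwa [add_comm (creat φ * _)] at h1

theorem formalAdjoint_opR2 (ħ m Ω : ℝ) : FormalAdjoint φ (opR2 φ ħ m Ω) (opR2 φ ħ m Ω) := by
  have e : opR2 φ ħ m Ω = ((-Ω / 2 * constC1 ħ m Ω : ℝ) : ℂ) • opS1 φ ħ m Ω := by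
    simp only [opR2, opS1]
    push_cast
    module
  rw [e]
  exact (formalAdjoint_opS1 φ ħ m Ω).smul (Complex.conj_ofReal _)

end Symmetric

section Evolution

/-- The projection onto the span of the first `N` number states. -/
def numberProj (N : ℕ) : E →L[ℂ] E :=
  ∑ k ∈ Finset.range N, (innerSL ℂ (φ k)).smulRight (φ k)

theorem numberProj_apply (N : ℕ) (x : E) :
    numberProj φ N x = ∑ k ∈ Finset.range N, ⟪φ k, x⟫_ℂ • φ k := by
  simp [numberProj]

theorem inner_numberProj (N j : ℕ) (x : E) :
    ⟪φ j, numberProj φ N x⟫_ℂ = if j < N then ⟪φ j, x⟫_ℂ else 0 := by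
  rw [numberProj_apply, inner_sum]
  simp [inner_smul_right, orthonormal_iff_ite.1 φ.orthonormal]

theorem numberProj_basis (N n : ℕ) : numberProj φ N (φ n) = if n < N then φ n else 0 := by
  rw [numberProj_apply]
  simp [orthonormal_iff_ite.1 φ.orthonormal]

variable {φ} in
theorem inner_fockSpan_eventually_zero (x : FockSpan φ) : ∃ N, ∀ n ≥ N, ⟪(x : E), φ n⟫_ℂ = 0 := by
  induction x using fockSpan_induction φ with
  | zero => exact ⟨0, fun n _ => by simp⟩
  | add x y hx hy =>
    obtain ⟨M, hM⟩ := hx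
    obtain ⟨N, hN⟩ := hy
    refine ⟨max M N, fun n hn => ?_⟩
    rw [Submodule.coe_add, inner_add_left, hM n (le_of_max_le_left hn),
      hN n (le_of_max_le_right hn), add_zero]
  | smul c x hx =>
    obtain ⟨N, hN⟩ := hx
    refine ⟨N, fun n hn => ?_⟩
    rw [Submodule.coe_smul, inner_smul_left, hN n hn, mul_zero]
  | basis k =>
    refine ⟨k + 1, fun n hn => ?_⟩
    rw [numberBasis_coe]
    exact φ.orthonormal.2 (by omega)

theorem hasSum_norm_inner_sq (x : E) : HasSum (fun n => ‖⟪φ n, x⟫_ℂ‖ ^ 2) (‖x‖ ^ 2) := by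
  have h := φ.hasSum_inner_mul_inner x x
  rw [inner_self_eq_norm_sq_to_K] at h
  have h2 := Complex.hasSum_re h
  convert h2 using 1
  · ext n
    rw [← inner_conj_symm x, Complex.conj_mul']
    norm_cast
  · norm_cast

/-- The coordinates with respect to the number states. -/
def numberFrame : CoordFrame E ℕ where
  coord n := (innerSL ℂ (φ n)).restrictScalars ℝ
  hasSum_sq := hasSum_norm_inner_sq φ
  box := Finset.range
  tendsto_box := Filter.tendsto_finset_range
  trunc N x := numberProj φ N x
  coord_trunc_mem N x i hi := by
    simpa using (inner_numberProj φ N i x).trans (if_pos (Finset.mem_range.1 hi))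
  coord_trunc_notMem N x i hi := by
    simpa using (inner_numberProj φ N i x).trans (if_neg (by simpa using hi))

theorem numberFrame_coord (n : ℕ) (x : E) : (numberFrame φ).coord n x = ⟪φ n, x⟫_ℂ := rfl

theorem numberProj_mem (N : ℕ) (x : E) : numberProj φ N x ∈ FockSpan φ := by
  rw [numberProj_apply]
  exact Submodule.sum_mem _ fun k _ => Submodule.smul_mem _ _ (Submodule.subset_span ⟨k, rfl⟩)

theorem inner_hamiltonian (ħ Ω : ℝ) (x : FockSpan φ) (n : ℕ) :
    ⟪φ n, (hamiltonian φ ħ Ω x : E)⟫_ℂ = ((ħ * Ω * (n + 1 / 2) : ℝ) : ℂ) * ⟪φ n, (x : E)⟫_ℂ := by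
  induction x using fockSpan_induction φ with
  | zero => simp
  | add x y hx hy => simp only [map_add, Submodule.coe_add, inner_add_right, hx, hy, mul_add]
  | smul c x hx =>
    simp only [map_smul, Submodule.coe_smul, inner_smul_right, hx]
    ring
  | basis k =>
    rw [hamiltonian_numberBasis, Submodule.coe_smul, inner_smul_right, numberBasis_coe]
    by_cases h : n = k
    · rw [h]
    · rw [φ.orthonormal.2 h, mul_zero, mul_zero]

theorem isClosable_hamiltonian (ħ Ω : ℝ) : (toUnbounded φ (hamiltonian φ ħ Ω)).IsClosable :=
  (numberFrame φ).isClosable (μ := fun n => ((ħ * Ω * (n + 1 / 2) : ℝ) : ℂ))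
    (fun x n => inner_hamiltonian φ ħ Ω x n) fun N x => numberProj_mem φ N x

theorem mem_graph_schrodingerGen_iff {ħ : ℝ} (hħ : 0 < ħ) (Ω : ℝ) (x y : E) :
    (x, y) ∈ (schrodingerGen φ ħ Ω).graph ↔
      ∀ n, (numberFrame φ).coord n y =
        ((-Ω * (n + 1 / 2) : ℝ) : ℂ) * Complex.I * (numberFrame φ).coord n x := by
  have hħ' : (ħ : ℂ) ≠ 0 := Complex.ofReal_ne_zero.2 hħ.ne'
  rw [schrodingerGen, mem_graph_smul_iff (by simp [hħ']),
    (numberFrame φ).mem_graph_closure_iff (G := toUnbounded φ (hamiltonian φ ħ Ω))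
      (μ := fun n => ((ħ * Ω * (n + 1 / 2) : ℝ) : ℂ))
      (fun x n => inner_hamiltonian φ ħ Ω x n) fun N x => numberProj_mem φ N x]
  refine forall_congr' fun n => ?_
  simp only [numberFrame_coord, inner_smul_right]
  rw [inv_mul_eq_iff_eq_mul₀ (by simp [hħ'])]
  have e : -(Complex.I / (ħ : ℂ)) * (((ħ * Ω * (n + 1 / 2) : ℝ) : ℂ) * ⟪φ n, x⟫_ℂ) =
      ((-Ω * (n + 1 / 2) : ℝ) : ℂ) * Complex.I * ⟪φ n, x⟫_ℂ := by
    push_cast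
    field_simp
  rw [e]

theorem numberProj_mem_domain (ħ Ω : ℝ) (N : ℕ) (x : E) :
    numberProj φ N x ∈ (schrodingerGen φ ħ Ω).domain :=
  (LinearPMap.le_closure (toUnbounded φ (hamiltonian φ ħ Ω))).1 (numberProj_mem φ N x)

theorem orthonormal_phase (θ : ℕ → ℝ) :
    Orthonormal ℂ fun n => Complex.exp (θ n * Complex.I) • φ n := by
  rw [orthonormal_iff_ite]
  intro i j
  rw [inner_smul_left, inner_smul_right, orthonormal_iff_ite.1 φ.orthonormal]
  split_ifs with h
  · rw [h, mul_one, Complex.conj_mul', Complex.norm_exp_ofReal_mul_I]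
    simp
  · simp

theorem dense_span_phase (θ : ℕ → ℝ) :
    ⊤ ≤ (Submodule.span ℂ
      (Set.range fun n => Complex.exp (θ n * Complex.I) • φ n)).topologicalClosure := by
  rw [← φ.dense_span]
  refine Submodule.topologicalClosure_mono (Submodule.span_le.2 ?_)
  rintro _ ⟨n, rfl⟩
  have h := Submodule.smul_mem _ (Complex.exp (θ n * Complex.I))⁻¹
    (Submodule.subset_span (R := ℂ)
      (Set.mem_range_self (f := fun n => Complex.exp (θ n * Complex.I) • φ n) n))
  rwa [inv_smul_smul₀ (Complex.exp_ne_zero _)] at h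

variable [CompleteSpace E]

/-- The unitary operator multiplying the number states by phases. -/
def phaseUnitary (θ : ℕ → ℝ) : E ≃ₗᵢ[ℂ] E :=
  φ.repr.trans (HilbertBasis.mk (orthonormal_phase φ θ) (dense_span_phase φ θ)).repr.symm

theorem phaseUnitary_apply_basis (θ : ℕ → ℝ) (n : ℕ) :
    phaseUnitary φ θ (φ n) = Complex.exp (θ n * Complex.I) • φ n := by
  classical
  rw [phaseUnitary, LinearIsometryEquiv.trans_apply, HilbertBasis.repr_self,
    HilbertBasis.repr_symm_single, HilbertBasis.coe_mk]

theorem inner_phaseUnitary (θ : ℕ → ℝ) (n : ℕ) (x : E) :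
    ⟪φ n, phaseUnitary φ θ x⟫_ℂ = Complex.exp (θ n * Complex.I) * ⟪φ n, x⟫_ℂ := by
  have h : φ n = Complex.exp (-(θ n * Complex.I)) • phaseUnitary φ θ (φ n) := by
    rw [phaseUnitary_apply_basis, smul_smul, ← Complex.exp_add]
    simp
  conv_lhs => rw [h]
  rw [inner_smul_left, LinearIsometryEquiv.inner_map_map, ← Complex.exp_conj]
  simp

/-- The unitary group of the oscillator. -/
def oscillatorUnitary (Ω t : ℝ) : E ≃ₗᵢ[ℂ] E :=
  phaseUnitary φ fun n => t * (-Ω * (n + 1 / 2))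

theorem coord_oscillatorUnitary (Ω t : ℝ) (x : E) (n : ℕ) :
    (numberFrame φ).coord n ((oscillatorUnitary φ Ω t : E →L[ℂ] E) x) =
      Complex.exp (t * (-Ω * (n + 1 / 2) : ℝ) * Complex.I) * (numberFrame φ).coord n x := by
  have h := inner_phaseUnitary φ (fun n => t * (-Ω * (n + 1 / 2))) n x
  rw [Complex.ofReal_mul] at h
  exact h

theorem isOpExp_oscillatorUnitary {ħ : ℝ} (hħ : 0 < ħ) (Ω : ℝ) :
    IsOpExp (schrodingerGen φ ħ Ω) fun t => (oscillatorUnitary φ Ω t : E →L[ℂ] E) :=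
  (numberFrame φ).isOpExp (mem_graph_schrodingerGen_iff φ hħ Ω)
    (numberProj_mem_domain φ ħ Ω) (coord_oscillatorUnitary φ Ω)

theorem isOpExp_schrodingerGen_unique {ħ : ℝ} (hħ : 0 < ħ) (Ω : ℝ) {S : ℝ → E →L[ℂ] E}
    (hS : IsOpExp (schrodingerGen φ ħ Ω) S) :
    S = fun t => (oscillatorUnitary φ Ω t : E →L[ℂ] E) :=
  (numberFrame φ).isOpExp_unique (mem_graph_schrodingerGen_iff φ hħ Ω)
    (numberProj_mem_domain φ ħ Ω) (coord_oscillatorUnitary φ Ω) hS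

theorem unitaryEvolution_eq {ħ : ℝ} (hħ : 0 < ħ) (Ω : ℝ) :
    unitaryEvolution φ ħ Ω = fun t => (oscillatorUnitary φ Ω t : E →L[ℂ] E) :=
  opExp_eq (isOpExp_oscillatorUnitary φ hħ Ω) fun _ => isOpExp_schrodingerGen_unique φ hħ Ω

end Evolution

end FockSpace

section PartialOperators

variable {𝕜 : Type*} [RCLike 𝕜] {V : Type*} [NormedAddCommGroup V] [NormedSpace 𝕜 V]

theorem mem_graph_pcomp_iff (g f : V →ₗ.[𝕜] V) (x z : V) :
    (x, z) ∈ (pcomp g f).graph ↔ ∃ y, (x, y) ∈ f.graph ∧ (y, z) ∈ g.graph := by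
  have hr : ∀ (S : Submodule 𝕜 V) (u : (f.domRestrict S).domain),
      f.domRestrict S u = f ⟨u, u.2.2⟩ := fun S u => LinearPMap.domRestrict_apply rfl
  simp only [LinearPMap.mem_graph_iff]
  constructor
  · rintro ⟨u, rfl, rfl⟩
    obtain ⟨y, hy, hyu⟩ := u.2.1
    refine ⟨f ⟨u, u.2.2⟩, ⟨⟨u, u.2.2⟩, rfl, rfl⟩, ⟨f ⟨u, u.2.2⟩, ?_⟩, rfl, ?_⟩
    · rw [show (⟨u, u.2.2⟩ : f.domain) = y from Subtype.ext hyu.symm]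
      exact hy
    · exact congrArg g (Subtype.ext (hr _ u).symm)
  · rintro ⟨_, ⟨u, rfl, rfl⟩, w, hw, rfl⟩
    have hu : f u ∈ g.domain := hw ▸ w.2
    refine ⟨⟨u, ⟨u, hu, rfl⟩, u.2⟩, rfl, ?_⟩
    exact congrArg g (Subtype.ext ((hr _ _).trans hw.symm))

theorem mem_graph_add_iff (f g : V →ₗ.[𝕜] V) (x y : V) :
    (x, y) ∈ (f + g).graph ↔ ∃ a b, (x, a) ∈ f.graph ∧ (x, b) ∈ g.graph ∧ a + b = y := by
  simp only [LinearPMap.mem_graph_iff]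
  constructor
  · rintro ⟨u, rfl, rfl⟩
    exact ⟨_, _, ⟨⟨u, u.2.1⟩, rfl, rfl⟩, ⟨⟨u, u.2.2⟩, rfl, rfl⟩, rfl⟩
  · rintro ⟨_, _, ⟨u, rfl, rfl⟩, ⟨w, hw, rfl⟩, rfl⟩
    refine ⟨⟨u, u.2, hw ▸ w.2⟩, rfl, ?_⟩
    exact congrArg (f u + ·) (show g ⟨u, hw ▸ w.2⟩ = g w from congrArg g (Subtype.ext hw.symm))

theorem mem_graph_sub_iff (f g : V →ₗ.[𝕜] V) (x y : V) :
    (x, y) ∈ (f - g).graph ↔ ∃ a b, (x, a) ∈ f.graph ∧ (x, b) ∈ g.graph ∧ a - b = y := by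
  simp only [LinearPMap.mem_graph_iff]
  constructor
  · rintro ⟨u, rfl, rfl⟩
    exact ⟨_, _, ⟨⟨u, u.2.1⟩, rfl, rfl⟩, ⟨⟨u, u.2.2⟩, rfl, rfl⟩, rfl⟩
  · rintro ⟨_, _, ⟨u, rfl, rfl⟩, ⟨w, hw, rfl⟩, rfl⟩
    refine ⟨⟨u, u.2, hw ▸ w.2⟩, rfl, ?_⟩
    exact congrArg (f u - ·) (show g ⟨u, hw ▸ w.2⟩ = g w from congrArg g (Subtype.ext hw.symm))

end PartialOperators

section HilbertSchmidt

variable {E : Type*} [NormedAddCommGroup E] [InnerProductSpace ℂ E] [CompleteSpace E]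
  (φ : HilbertBasis ℕ ℂ E)

namespace JordanHS

variable {φ}

theorem isSelfAdjoint (v : JordanHS φ) : IsSelfAdjoint v.op := v.2.1

theorem inner_op_left (v : JordanHS φ) (x y : E) : ⟪v.op x, y⟫_ℂ = ⟪x, v.op y⟫_ℂ := by
  rw [← ContinuousLinearMap.adjoint_inner_right, v.isSelfAdjoint.adjoint_eq]

theorem hasSum_norm_sq (v : JordanHS φ) : HasSum (fun n => ‖v.op (φ n)‖ ^ 2) (‖v‖ ^ 2) := by
  have h1 : ‖v‖ ^ 2 = ∑' n, ‖v.op (φ n)‖ ^ 2 := by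
    rw [← real_inner_self_eq_norm_sq]
    exact tsum_congr fun n => inner_self_eq_norm_sq (𝕜 := ℂ) _
  rw [h1]
  exact v.2.2.hasSum

theorem norm_op_basis_le (v : JordanHS φ) (n : ℕ) : ‖v.op (φ n)‖ ≤ ‖v‖ :=
  le_of_sq_le_sq (le_hasSum v.hasSum_norm_sq n fun _ _ => by positivity) (norm_nonneg _)

/-- The matrix elements `⟨j|v|k⟩`. -/
def matrixElement (k j : ℕ) : JordanHS φ →L[ℝ] ℂ :=
  LinearMap.mkContinuous
    { toFun := fun v => ⟪φ j, v.op (φ k)⟫_ℂ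
      map_add' := fun v w => by rw [op_add, add_apply, inner_add_right]
      map_smul' := fun c v => by
        rw [op_smul, smul_apply, ← Complex.coe_smul, inner_smul_right, RingHom.id_apply,
          Complex.real_smul] } 1
    fun v => by
      rw [one_mul]
      refine (norm_inner_le_norm _ _).trans ?_
      rw [φ.orthonormal.1, one_mul]
      exact v.norm_op_basis_le k

theorem matrixElement_apply (k j : ℕ) (v : JordanHS φ) :
    matrixElement k j v = ⟪φ j, v.op (φ k)⟫_ℂ := rfl

theorem hasSum_matrixElement_sq (v : JordanHS φ) :
    HasSum (fun p : ℕ × ℕ => ‖matrixElement p.1 p.2 v‖ ^ 2) (‖v‖ ^ 2) := by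
  have h1 : ∀ k, HasSum (fun j => ‖matrixElement k j v‖ ^ 2) (‖v.op (φ k)‖ ^ 2) :=
    fun k => hasSum_norm_inner_sq φ _
  have hs : Summable fun p : ℕ × ℕ => ‖matrixElement p.1 p.2 v‖ ^ 2 := by
    refine (summable_prod_of_nonneg fun p => by positivity).2 ⟨fun k => (h1 k).summable, ?_⟩
    simp only [fun k => (h1 k).tsum_eq]
    exact v.2.2
  have h2 := hs.hasSum.prod_fiberwise h1
  rw [v.hasSum_norm_sq.unique h2]
  exact hs.hasSum

/-- A self-adjoint operator with finitely many nonzero columns. -/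
def ofFinite (w : E →L[ℂ] E) (hw : IsSelfAdjoint w) (N : ℕ) (h : ∀ n ≥ N, w (φ n) = 0) :
    JordanHS φ :=
  show jordanHSSubmodule φ from ⟨w, hw, summable_of_ne_finset_zero (s := Finset.range N)
    fun n hn => by simp [h n (by simpa using hn)]⟩

end JordanHS

open JordanHS

theorem isSelfAdjoint_numberProj (N : ℕ) : IsSelfAdjoint (numberProj φ N) := by
  rw [ContinuousLinearMap.isSelfAdjoint_iff']
  refine (ContinuousLinearMap.eq_adjoint_iff _ _).2 (fun x y => ?_) |>.symm
  simp only [numberProj_apply, sum_inner, inner_sum, inner_smul_left, inner_smul_right,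
    inner_conj_symm]
  exact Finset.sum_congr rfl fun k _ => mul_comm _ _

/-- The compression of `v` to the span of the first `N` number states. -/
def compress (N : ℕ) (v : JordanHS φ) : JordanHS φ :=
  ofFinite (numberProj φ N * v.op * numberProj φ N)
    (v.isSelfAdjoint.conjugate_self (isSelfAdjoint_numberProj φ N)) N fun n hn => by
      rw [mul_apply_eq_comp, numberProj_basis, if_neg hn.not_gt, map_zero]

theorem op_compress_basis (N n : ℕ) (v : JordanHS φ) :
    (compress φ N v).op (φ n) = if n < N then numberProj φ N (v.op (φ n)) else 0 := by
  change numberProj φ N (v.op (numberProj φ N (φ n))) = _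
  rw [numberProj_basis]
  split_ifs <;> simp

/-- The coordinates of a Hilbert–Schmidt operator given by its matrix elements. -/
def matrixFrame : CoordFrame (JordanHS φ) (ℕ × ℕ) where
  coord p := matrixElement p.1 p.2
  hasSum_sq := hasSum_matrixElement_sq
  box N := Finset.range N ×ˢ Finset.range N
  tendsto_box := by
    refine Filter.tendsto_atTop_finset_of_monotone (fun M N h => ?_) fun p => ?_
    · exact Finset.product_subset_product (Finset.range_mono h) (Finset.range_mono h)
    · refine ⟨max p.1 p.2 + 1, ?_⟩
      simp
  trunc N v := compress φ N v
  coord_trunc_mem N v p hp := by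
    have hp' := Finset.mem_product.1 hp
    rw [matrixElement_apply, op_compress_basis, if_pos (Finset.mem_range.1 hp'.1),
      inner_numberProj, if_pos (Finset.mem_range.1 hp'.2), matrixElement_apply]
  coord_trunc_notMem N v p hp := by
    rw [matrixElement_apply, op_compress_basis]
    split_ifs with h
    · rw [inner_numberProj, if_neg]
      exact fun h2 => hp (Finset.mem_product.2 ⟨Finset.mem_range.2 h, Finset.mem_range.2 h2⟩)
    · exact inner_zero_right _

theorem matrixFrame_coord (p : ℕ × ℕ) (v : JordanHS φ) :
    (matrixFrame φ).coord p v = ⟪φ p.2, v.op (φ p.1)⟫_ℂ := rfl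

section JordanMultiplication

theorem graph_jordanL (R : Module.End ℂ (FockSpan φ)) :
    (jordanL φ R).graph = jordanMulGraph φ R :=
  Submodule.toLinearPMap_graph_eq _ (jordanMulGraph_functional φ R)

variable {φ}

theorem op_eq_sum_of_finite {v : JordanHS φ} {N : ℕ} (hv : ∀ n ≥ N, v.op (φ n) = 0) (x : E) :
    v.op x = ∑ k ∈ Finset.range N, ⟪φ k, x⟫_ℂ • v.op (φ k) := by
  refine (numberFrame φ).ext fun j => ?_
  have h := ((φ.hasSum_repr x).mapL v.op)
  have h2 : HasSum (fun k => v.op (φ.repr x k • φ k))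
      (∑ k ∈ Finset.range N, v.op (φ.repr x k • φ k)) :=
    hasSum_sum_of_ne_finset_zero fun k hk => by
      rw [map_smul, hv k (by simpa using hk), smul_zero]
  rw [h.unique h2]
  simp only [map_smul, HilbertBasis.repr_apply_apply]

theorem op_mem_fockSpan_of_finite {v : JordanHS φ} {N : ℕ} (hv : ∀ n ≥ N, v.op (φ n) = 0) (x : E) :
    v.op x ∈ FockSpan φ := by
  have h : v.op x = numberProj φ N (v.op x) := by
    refine (numberFrame φ).ext fun j => ?_
    rw [numberFrame_coord, numberFrame_coord, inner_numberProj]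
    split_ifs with hj
    · rfl
    · rw [← inner_op_left, hv j (not_lt.1 hj), inner_zero_left]
  rw [h]
  exact numberProj_mem φ N _

/-- Jordan multiplication by a symmetric operator is defined on operators with finitely many nonzero
matrix elements and preserves them. -/
theorem exists_mem_jordanMulGraph_of_finite {R : Module.End ℂ (FockSpan φ)}
    (hR : FormalAdjoint φ R R) {v : JordanHS φ} {N : ℕ} (hv : ∀ n ≥ N, v.op (φ n) = 0) :
    ∃ w : JordanHS φ, (∃ M, ∀ n ≥ M, w.op (φ n) = 0) ∧ (v, w) ∈ (jordanL φ R).graph := by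
  set c : ℕ → FockSpan φ := fun k => R ⟨v.op (φ k), op_mem_fockSpan_of_finite hv _⟩ with hc
  set B : E →L[ℂ] E := ∑ k ∈ Finset.range N, (innerSL ℂ (φ k)).smulRight (c k : E) with hB
  have hBx : ∀ x : E, B x = ∑ k ∈ Finset.range N, ⟪φ k, x⟫_ℂ • (c k : E) := fun x => by
    simp [hB]
  have hBR : ∀ x, B x = (R ⟨v.op x, op_mem_fockSpan_of_finite hv x⟩ : E) := by
    intro x
    have e : (⟨v.op x, op_mem_fockSpan_of_finite hv x⟩ : FockSpan φ) =
        ∑ k ∈ Finset.range N, ⟪φ k, x⟫_ℂ • ⟨v.op (φ k), op_mem_fockSpan_of_finite hv _⟩ := by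
      apply Subtype.ext
      rw [Submodule.coe_sum]
      exact op_eq_sum_of_finite hv x
    rw [hBx, e, map_sum, Submodule.coe_sum]
    exact Finset.sum_congr rfl fun k _ => by rw [map_smul, Submodule.coe_smul]
  have hsa : IsSelfAdjoint ((1 / 2 : ℂ) • (B + star B)) := by
    have h : star (1 / 2 : ℂ) = 1 / 2 := by simp
    rw [isSelfAdjoint_iff, star_smul, star_add, star_star, add_comm, h]
  have hfin : ∃ M, ∀ n ≥ M, ((1 / 2 : ℂ) • (B + star B)) (φ n) = 0 := by
    choose m hm using fun k => inner_fockSpan_eventually_zero (c k)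
    refine ⟨max N ((Finset.range N).sup m), fun n hn => ?_⟩
    have h1 : B (φ n) = 0 := by
      rw [hBx]
      refine Finset.sum_eq_zero fun k hk => ?_
      have : k < N := Finset.mem_range.1 hk
      rw [φ.orthonormal.2 (by have := le_of_max_le_left hn; omega), zero_smul]
    have h2 : star B (φ n) = 0 := by
      refine ext_inner_left ℂ fun x => ?_
      rw [ContinuousLinearMap.star_eq_adjoint, ContinuousLinearMap.adjoint_inner_right, hBx,
        sum_inner, inner_zero_right]
      refine Finset.sum_eq_zero fun k hk => ?_
      rw [inner_smul_left, hm k n ((Finset.le_sup hk).trans (le_of_max_le_right hn)), mul_zero]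
    rw [smul_apply, add_apply, h1, h2, add_zero, smul_zero]
  obtain ⟨M, hM⟩ := hfin
  refine ⟨ofFinite _ hsa M hM, ⟨M, hM⟩, ?_⟩
  rw [graph_jordanL]
  intro x y
  change ⟪(x : E), ((1 / 2 : ℂ) • (B + star B)) y⟫_ℂ =
    (1 / 2 : ℂ) * (⟪(R x : E), v.op y⟫_ℂ + ⟪(x : E), v.op (R y)⟫_ℂ)
  have h1 : ⟪(x : E), B y⟫_ℂ = ⟪(R x : E), v.op y⟫_ℂ := by
    rw [hBR]
    have h := hR x ⟨v.op y, op_mem_fockSpan_of_finite hv y⟩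
    simp only [Submodule.coe_inner] at h
    exact h.symm
  have h2 : ⟪(x : E), star B y⟫_ℂ = ⟪(x : E), v.op (R y)⟫_ℂ := by
    rw [ContinuousLinearMap.star_eq_adjoint, ContinuousLinearMap.adjoint_inner_right, hBR,
      ← inner_op_left]
    have h := hR ⟨v.op x, op_mem_fockSpan_of_finite hv x⟩ y
    simp only [Submodule.coe_inner] at h
    exact h
  rw [smul_apply, add_apply, inner_smul_right, inner_add_right, h1, h2]

theorem exists_mem_pcomp_of_finite {R S : Module.End ℂ (FockSpan φ)}
    (hR : FormalAdjoint φ R R) (hS : FormalAdjoint φ S S) {v : JordanHS φ} {N : ℕ}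
    (hv : ∀ n ≥ N, v.op (φ n) = 0) :
    ∃ w, (v, w) ∈ (pcomp (jordanL φ S) (jordanL φ R)).graph := by
  obtain ⟨u, ⟨M, hM⟩, hu⟩ := exists_mem_jordanMulGraph_of_finite hR hv
  obtain ⟨w, -, hw⟩ := exists_mem_jordanMulGraph_of_finite hS hM
  exact ⟨w, (mem_graph_pcomp_iff _ _ _ _).2 ⟨u, hu, hw⟩⟩

theorem exists_mem_pcommutator_of_finite {R S : Module.End ℂ (FockSpan φ)}
    (hR : FormalAdjoint φ R R) (hS : FormalAdjoint φ S S) {v : JordanHS φ} {N : ℕ}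
    (hv : ∀ n ≥ N, v.op (φ n) = 0) :
    ∃ w, (v, w) ∈ (pcommutator (jordanL φ S) (jordanL φ R)).graph := by
  obtain ⟨a, ha⟩ := exists_mem_pcomp_of_finite hR hS hv
  obtain ⟨b, hb⟩ := exists_mem_pcomp_of_finite hS hR hv
  exact ⟨a - b, (mem_graph_sub_iff _ _ _ _).2 ⟨a, b, ha, hb, rfl⟩⟩

theorem mem_domain_jordanK_of_finite (ħ m Ω : ℝ) {v : JordanHS φ} {N : ℕ}
    (hv : ∀ n ≥ N, v.op (φ n) = 0) : v ∈ (jordanK φ ħ m Ω).domain := by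
  obtain ⟨a, ha⟩ := exists_mem_pcommutator_of_finite (formalAdjoint_opR1 φ ħ m Ω)
    (formalAdjoint_opS1 φ ħ m Ω) hv
  obtain ⟨b, hb⟩ := exists_mem_pcommutator_of_finite (formalAdjoint_opR2 φ ħ m Ω)
    (formalAdjoint_opS2 φ) hv
  exact LinearPMap.mem_domain_of_mem_graph ((mem_graph_add_iff _ _ _ _).2 ⟨a, b, ha, hb, rfl⟩)

theorem inner_pcomp_jordanL {R S : Module.End ℂ (FockSpan φ)} {v w : JordanHS φ}
    (h : (v, w) ∈ (pcomp (jordanL φ S) (jordanL φ R)).graph) (x y : FockSpan φ) :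
    ⟪(x : E), w.op y⟫_ℂ = (1 / 4 : ℂ) *
      (⟪(R (S x) : E), v.op y⟫_ℂ + ⟪(S x : E), v.op (R y)⟫_ℂ + ⟪(R x : E), v.op (S y)⟫_ℂ +
        ⟪(x : E), v.op (R (S y))⟫_ℂ) := by
  obtain ⟨u, hu, hw⟩ := (mem_graph_pcomp_iff _ _ _ _).1 h
  rw [graph_jordanL] at hu hw
  have h1 := hw x y
  have h2 := hu (S x) y
  have h3 := hu x (S y)
  simp only at h1 h2 h3
  rw [h1, h2, h3]
  ring

theorem inner_pcommutator_jordanL {R S : Module.End ℂ (FockSpan φ)} {v w : JordanHS φ}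
    (h : (v, w) ∈ (pcommutator (jordanL φ S) (jordanL φ R)).graph) (x y : FockSpan φ) :
    ⟪(x : E), w.op y⟫_ℂ =
      (1 / 4 : ℂ) * (⟪(⁅R, S⁆ x : E), v.op y⟫_ℂ + ⟪(x : E), v.op (⁅R, S⁆ y)⟫_ℂ) := by
  obtain ⟨a, b, ha, hb, rfl⟩ := (mem_graph_sub_iff _ _ _ _).1 h
  have e : (a - b).op = a.op - b.op := rfl
  rw [e, sub_apply, inner_sub_right, inner_pcomp_jordanL ha, inner_pcomp_jordanL hb]
  simp only [Ring.lie_def, LinearMap.sub_apply, Module.End.mul_apply, Submodule.coe_sub,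
    inner_sub_left, inner_sub_right, map_sub]
  ring

theorem matrixElement_jordanK {ħ m Ω : ℝ} (hħ : 0 < ħ) (hm : 0 < m) (hΩ : 0 < Ω)
    (v : (jordanK φ ħ m Ω).domain) (p : ℕ × ℕ) :
    (matrixFrame φ).coord p (jordanK φ ħ m Ω v) =
      ((ħ * Ω * ((p.2 : ℝ) - p.1) / 4 : ℝ) : ℂ) * Complex.I * (matrixFrame φ).coord p v := by
  obtain ⟨a, b, ha, hb, hab⟩ := (mem_graph_add_iff _ _ _ _).1 ((jordanK φ ħ m Ω).mem_graph v)
  rw [← hab, map_add]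
  have h1 := inner_pcommutator_jordanL ha (numberBasis φ p.2) (numberBasis φ p.1)
  have h2 := inner_pcommutator_jordanL hb (numberBasis φ p.2) (numberBasis φ p.1)
  have hC : ⁅opR1 φ ħ m Ω, opS1 φ ħ m Ω⁆ + ⁅opR2 φ ħ m Ω, opS2 φ⁆ =
      (-Complex.I) • hamiltonian φ ħ Ω := by
    rw [hamiltonian_eq_commutators φ hħ hm hΩ, ← smul_add, smul_smul]
    simp
  have h3 : ∀ k, ((⁅opR1 φ ħ m Ω, opS1 φ ħ m Ω⁆ (numberBasis φ k) : FockSpan φ) : E) +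
      (⁅opR2 φ ħ m Ω, opS2 φ⁆ (numberBasis φ k) : FockSpan φ) =
      (-Complex.I * ((ħ * Ω * (k + 1 / 2) : ℝ) : ℂ)) • φ k := by
    intro k
    rw [← Submodule.coe_add, ← LinearMap.add_apply, hC, LinearMap.smul_apply,
      hamiltonian_numberBasis, smul_smul, Submodule.coe_smul, numberBasis_coe]
  simp only [matrixFrame_coord]
  rw [← numberBasis_coe φ p.1, ← numberBasis_coe φ p.2, h1, h2]
  have h4 := congrArg (fun z : E => ⟪z, (v : JordanHS φ).op (φ p.1)⟫_ℂ) (h3 p.2)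
  have h5 := congrArg (fun z : E => ⟪φ p.2, (v : JordanHS φ).op z⟫_ℂ) (h3 p.1)
  simp only [inner_add_left, inner_smul_left, map_add, map_smul, inner_add_right, inner_smul_right,
    map_mul, map_neg, Complex.conj_I, Complex.conj_ofReal] at h4 h5
  simp only [numberBasis_coe]
  push_cast at h4 h5 ⊢
  linear_combination (1 / 4 : ℂ) * h4 + (1 / 4 : ℂ) * h5

theorem compress_mem_domain_jordanK (ħ m Ω : ℝ) (N : ℕ) (v : JordanHS φ) :
    compress φ N v ∈ (jordanK φ ħ m Ω).domain :=
  mem_domain_jordanK_of_finite ħ m Ω (N := N) fun n hn => by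
    rw [op_compress_basis, if_neg hn.not_gt]

variable (φ)

theorem isClosable_jordanK {ħ m Ω : ℝ} (hħ : 0 < ħ) (hm : 0 < m) (hΩ : 0 < Ω) :
    (jordanK φ ħ m Ω).IsClosable :=
  (matrixFrame φ).isClosable (matrixElement_jordanK hħ hm hΩ)
    fun N v => compress_mem_domain_jordanK ħ m Ω N v

theorem mem_graph_jordanGen_iff {ħ m Ω : ℝ} (hħ : 0 < ħ) (hm : 0 < m) (hΩ : 0 < Ω)
    (x y : JordanHS φ) :
    (x, y) ∈ ((-(4 / ħ)) • (jordanK φ ħ m Ω).closure).graph ↔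
      ∀ p, (matrixFrame φ).coord p y =
        ((-Ω * ((p.2 : ℝ) - p.1) : ℝ) : ℂ) * Complex.I * (matrixFrame φ).coord p x := by
  have ha : -(4 / ħ) ≠ 0 := by simp [hħ.ne']
  rw [mem_graph_smul_iff ha, (matrixFrame φ).mem_graph_closure_iff
    (matrixElement_jordanK hħ hm hΩ) fun N v => compress_mem_domain_jordanK ħ m Ω N v]
  refine forall_congr' fun p => ?_
  have hħ' : (ħ : ℂ) ≠ 0 := Complex.ofReal_ne_zero.2 hħ.ne'
  rw [map_smul, inv_smul_eq_iff₀ ha, Complex.real_smul]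
  have e : ((-(4 / ħ) : ℝ) : ℂ) * (((ħ * Ω * ((p.2 : ℝ) - p.1) / 4 : ℝ) : ℂ) * Complex.I *
      (matrixFrame φ).coord p x) =
      ((-Ω * ((p.2 : ℝ) - p.1) : ℝ) : ℂ) * Complex.I * (matrixFrame φ).coord p x := by
    push_cast
    field_simp
  rw [e]

theorem compress_mem_domain_jordanGen (ħ m Ω : ℝ) (N : ℕ) (v : JordanHS φ) :
    compress φ N v ∈ ((-(4 / ħ)) • (jordanK φ ħ m Ω).closure).domain :=
  (LinearPMap.le_closure (jordanK φ ħ m Ω)).1 (compress_mem_domain_jordanK ħ m Ω N v)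

end JordanMultiplication

section Conjugation

theorem adjoint_phaseUnitary_basis (θ : ℕ → ℝ) (n : ℕ) :
    ContinuousLinearMap.adjoint (phaseUnitary φ θ : E →L[ℂ] E) (φ n) =
      Complex.exp (-(θ n * Complex.I)) • φ n := by
  refine (numberFrame φ).ext fun j => ?_
  rw [numberFrame_coord, numberFrame_coord, ContinuousLinearMap.adjoint_inner_right]
  change ⟪phaseUnitary φ θ (φ j), φ n⟫_ℂ = _
  rw [phaseUnitary_apply_basis, inner_smul_left, inner_smul_right,
    orthonormal_iff_ite.1 φ.orthonormal, ← Complex.exp_conj]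
  split_ifs with h
  · simp [h]
  · simp

variable {φ} in
/-- Conjugation of a Hilbert–Schmidt operator by a unitary operator diagonal in the number states. -/
def phaseConjOp (θ : ℕ → ℝ) (v : JordanHS φ) : JordanHS φ :=
  show jordanHSSubmodule φ from
    ⟨(phaseUnitary φ θ : E →L[ℂ] E) ∘L v.op ∘L
        ContinuousLinearMap.adjoint (phaseUnitary φ θ : E →L[ℂ] E),
      v.isSelfAdjoint.conjugate (phaseUnitary φ θ : E →L[ℂ] E), by
        convert v.2.2 using 3 with n
        change ‖phaseUnitary φ θ (v.op
          (ContinuousLinearMap.adjoint (phaseUnitary φ θ : E →L[ℂ] E) (φ n)))‖ = ‖v.op (φ n)‖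
        rw [LinearIsometryEquiv.norm_map, adjoint_phaseUnitary_basis, map_smul, norm_smul,
          ← neg_mul, ← Complex.ofReal_neg, Complex.norm_exp_ofReal_mul_I, one_mul]⟩

theorem op_phaseConjOp (θ : ℕ → ℝ) (v : JordanHS φ) :
    (phaseConjOp θ v).op = (phaseUnitary φ θ : E →L[ℂ] E) ∘L v.op ∘L
        ContinuousLinearMap.adjoint (phaseUnitary φ θ : E →L[ℂ] E) := rfl

theorem op_phaseConjOp_basis (θ : ℕ → ℝ) (v : JordanHS φ) (n : ℕ) :
    (phaseConjOp θ v).op (φ n) =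
      Complex.exp (-(θ n * Complex.I)) • phaseUnitary φ θ (v.op (φ n)) := by
  rw [op_phaseConjOp]
  simp only [ContinuousLinearMap.comp_apply, adjoint_phaseUnitary_basis, map_smul]
  rfl

theorem norm_phaseConjOp (θ : ℕ → ℝ) (v : JordanHS φ) : ‖phaseConjOp θ v‖ = ‖v‖ := by
  have h := (phaseConjOp θ v).hasSum_norm_sq
  have e : (fun n => ‖(phaseConjOp θ v).op (φ n)‖ ^ 2) = fun n => ‖v.op (φ n)‖ ^ 2 := by
    ext n
    rw [op_phaseConjOp_basis, norm_smul, ← neg_mul, ← Complex.ofReal_neg,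
      Complex.norm_exp_ofReal_mul_I, one_mul, LinearIsometryEquiv.norm_map]
  rw [e] at h
  exact (sq_eq_sq₀ (norm_nonneg _) (norm_nonneg _)).1 (h.unique v.hasSum_norm_sq)

/-- Conjugation by a diagonal unitary operator, as an isometry. -/
def phaseConj (θ : ℕ → ℝ) : JordanHS φ →ₗᵢ[ℝ] JordanHS φ where
  toFun := phaseConjOp θ
  map_add' v w := op_injective <| ContinuousLinearMap.ext fun x => by
    simp [op_phaseConjOp, op_add]
  map_smul' c v := op_injective <| ContinuousLinearMap.ext fun x => by
    simp only [op_phaseConjOp, op_smul, RingHom.id_apply, ContinuousLinearMap.comp_apply,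
      smul_apply, ← Complex.coe_smul, map_smul]
  norm_map' := norm_phaseConjOp φ θ

/-- The evolution of Hilbert–Schmidt operators by conjugation with the unitary group of the
oscillator. -/
def oscillatorConj (Ω t : ℝ) : JordanHS φ →ₗᵢ[ℝ] JordanHS φ :=
  phaseConj φ fun n => t * (-Ω * (n + 1 / 2))

theorem op_oscillatorConj (Ω t : ℝ) (v : JordanHS φ) :
    (oscillatorConj φ Ω t v).op = (oscillatorUnitary φ Ω t : E →L[ℂ] E) ∘L v.op ∘L
        ContinuousLinearMap.adjoint (oscillatorUnitary φ Ω t : E →L[ℂ] E) := rfl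

theorem op_oscillatorConj_basis_eq_zero (Ω t : ℝ) {v : JordanHS φ} {n : ℕ}
    (h : v.op (φ n) = 0) : (oscillatorConj φ Ω t v).op (φ n) = 0 := by
  refine (op_phaseConjOp_basis φ _ v n).trans ?_
  rw [h, map_zero, smul_zero]

theorem coord_oscillatorConj (Ω t : ℝ) (v : JordanHS φ) (p : ℕ × ℕ) :
    (matrixFrame φ).coord p ((oscillatorConj φ Ω t).toContinuousLinearMap v) =
      Complex.exp (t * (-Ω * ((p.2 : ℝ) - p.1) : ℝ) * Complex.I) *
        (matrixFrame φ).coord p v := by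
  rw [matrixFrame_coord, matrixFrame_coord]
  have h := op_phaseConjOp_basis φ (fun n => t * (-Ω * (n + 1 / 2))) v p.1
  have h2 := congrArg (fun z => ⟪φ p.2, z⟫_ℂ) h
  refine h2.trans ?_
  simp only [inner_smul_right, inner_phaseUnitary]
  rw [← mul_assoc, ← Complex.exp_add]
  congr 2
  push_cast
  ring

theorem isOpExp_oscillatorConj {ħ m Ω : ℝ} (hħ : 0 < ħ) (hm : 0 < m) (hΩ : 0 < Ω) :
    IsOpExp ((-(4 / ħ)) • (jordanK φ ħ m Ω).closure)
      fun t => (oscillatorConj φ Ω t).toContinuousLinearMap :=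
  (matrixFrame φ).isOpExp (mem_graph_jordanGen_iff φ hħ hm hΩ)
    (compress_mem_domain_jordanGen φ ħ m Ω) (coord_oscillatorConj φ Ω)

theorem isOpExp_jordanGen_unique {ħ m Ω : ℝ} (hħ : 0 < ħ) (hm : 0 < m) (hΩ : 0 < Ω)
    {S : ℝ → JordanHS φ →L[ℝ] JordanHS φ}
    (hS : IsOpExp ((-(4 / ħ)) • (jordanK φ ħ m Ω).closure) S) :
    S = fun t => (oscillatorConj φ Ω t).toContinuousLinearMap :=
  (matrixFrame φ).isOpExp_unique (mem_graph_jordanGen_iff φ hħ hm hΩ)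
    (compress_mem_domain_jordanGen φ ħ m Ω) (coord_oscillatorConj φ Ω) hS

theorem jordanEvolution_eq {ħ m Ω : ℝ} (hħ : 0 < ħ) (hm : 0 < m) (hΩ : 0 < Ω) :
    jordanEvolution φ ħ m Ω = fun t => (oscillatorConj φ Ω t).toContinuousLinearMap :=
  opExp_eq (isOpExp_oscillatorConj φ hħ hm hΩ) fun _ => isOpExp_jordanGen_unique φ hħ hm hΩ

theorem dense_domain_jordanGen (ħ m Ω : ℝ) :
    Dense (((-(4 / ħ)) • (jordanK φ ħ m Ω).closure).domain : Set (JordanHS φ)) := fun v =>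
  mem_closure_of_tendsto ((matrixFrame φ).tendsto_trunc v)
    (Filter.Eventually.of_forall fun N => compress_mem_domain_jordanGen φ ħ m Ω N v)

end Conjugation

end HilbertSchmidt

section TensorEvolution

variable {V W : Type*} [NormedAddCommGroup V] [InnerProductSpace ℝ V]
  [NormedAddCommGroup W] [InnerProductSpace ℝ W]

/-- Elementary tensors in the Hilbert tensor product, as a bounded bilinear map. -/
def hilbertTmul (V W : Type*) [NormedAddCommGroup V] [InnerProductSpace ℝ V]
    [NormedAddCommGroup W] [InnerProductSpace ℝ W] :
    V →L[ℝ] W →L[ℝ] UniformSpace.Completion (V ⊗[ℝ] W) :=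
  (ContinuousLinearMap.compL ℝ W (V ⊗[ℝ] W) (UniformSpace.Completion (V ⊗[ℝ] W))
    UniformSpace.Completion.toComplL) ∘L TensorProduct.mkL ℝ V W

theorem hilbertTmul_apply (v : V) (w : W) :
    hilbertTmul V W v w = ((v ⊗ₜ[ℝ] w : V ⊗[ℝ] W) : UniformSpace.Completion (V ⊗[ℝ] W)) := rfl

theorem inner_hilbertTmul (v v' : V) (w w' : W) :
    ⟪hilbertTmul V W v w, hilbertTmul V W v' w'⟫_ℝ = ⟪v, v'⟫_ℝ * ⟪w, w'⟫_ℝ := by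
  rw [hilbertTmul_apply, hilbertTmul_apply, UniformSpace.Completion.inner_coe,
    TensorProduct.inner_tmul]

theorem eq_zero_of_inner_hilbertTmul {z : UniformSpace.Completion (V ⊗[ℝ] W)}
    (h : ∀ v w, ⟪z, hilbertTmul V W v w⟫_ℝ = 0) : z = 0 := by
  have h1 : ∀ y : V ⊗[ℝ] W, ⟪z, (y : UniformSpace.Completion (V ⊗[ℝ] W))⟫_ℝ = 0 := by
    intro y
    induction y using TensorProduct.induction_on with
    | zero => rw [UniformSpace.Completion.coe_zero, inner_zero_right]
    | tmul v w => exact h v w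
    | add a b ha hb => rw [UniformSpace.Completion.coe_add, inner_add_right, ha, hb, add_zero]
  have h2 : ∀ y : UniformSpace.Completion (V ⊗[ℝ] W), ⟪z, y⟫_ℝ = 0 := fun y => by
    induction y using UniformSpace.Completion.induction_on with
    | hp => exact isClosed_eq (by fun_prop) continuous_const
    | ih a => exact h1 a
  exact inner_self_eq_zero.1 (h2 z)

theorem hasDerivAt_hilbertTmul {v : ℝ → V} {w : ℝ → W} {v' : V} {w' : W} {t : ℝ}
    (hv : HasDerivAt v v' t) (hw : HasDerivAt w w' t) :
    HasDerivAt (fun s => hilbertTmul V W (v s) (w s))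
      (hilbertTmul V W v' (w t) + hilbertTmul V W (v t) w') t := by
  have h := (hilbertTmul V W).hasDerivAt_of_bilinear (fun _ => hv) (fun _ => hw)
  rwa [add_comm] at h

/-- The generator of a group of isometries is antisymmetric. -/
theorem IsOpExp.inner_generator {G : V →ₗ.[ℝ] V} {T : ℝ → V →ₗᵢ[ℝ] V}
    (hT : IsOpExp G fun t => (T t).toContinuousLinearMap) {x x' y y' : V}
    (h : (x, y) ∈ G.graph) (h' : (x', y') ∈ G.graph) : ⟪x, y'⟫_ℝ + ⟪y, x'⟫_ℝ = 0 := by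
  have h1 := (hT.hasDerivAt h 0).inner ℝ (hT.hasDerivAt h' 0)
  simp only [LinearIsometry.coe_toContinuousLinearMap, LinearIsometry.inner_map_map] at h1
  exact h1.unique (hasDerivAt_const (0 : ℝ) _)

theorem hilbertTmul_eq_of_hasDerivAt {G : V →ₗ.[ℝ] V} {T : ℝ → V →ₗᵢ[ℝ] V}
    (hT : IsOpExp G fun t => (T t).toContinuousLinearMap) (hG : Dense (G.domain : Set V))
    {G' : W →ₗ.[ℝ] W} {T' : ℝ → W →ₗᵢ[ℝ] W}
    (hT' : IsOpExp G' fun t => (T' t).toContinuousLinearMap) (hG' : Dense (G'.domain : Set W))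
    {v v' : ℝ → V} {w w' : ℝ → W} (hv : ∀ t, (v t, v' t) ∈ G.graph)
    (hw : ∀ t, (w t, w' t) ∈ G'.graph)
    (h : ∀ t, HasDerivAt (fun s => hilbertTmul V W (v s) (w s))
      (hilbertTmul V W (v' t) (w t) + hilbertTmul V W (v t) (w' t)) t) (t : ℝ) :
    hilbertTmul V W (v t) (w t) = hilbertTmul V W (T t (v 0)) (T' t (w 0)) := by
  have hconst : ∀ a ∈ G.domain, ∀ b ∈ G'.domain,
      ⟪hilbertTmul V W (v t) (w t), hilbertTmul V W (T t a) (T' t b)⟫_ℝ =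
        ⟪hilbertTmul V W (T t (v 0)) (T' t (w 0)), hilbertTmul V W (T t a) (T' t b)⟫_ℝ := by
    intro a ha b hb
    have ga := G.mem_graph ⟨a, ha⟩
    have gb := G'.mem_graph ⟨b, hb⟩
    have hd : ∀ s, HasDerivAt (fun s => ⟪hilbertTmul V W (v s) (w s),
        hilbertTmul V W (T s a) (T' s b)⟫_ℝ) 0 s := by
      intro s
      have h1 := (h s).inner ℝ (hasDerivAt_hilbertTmul (hT.hasDerivAt ga s) (hT'.hasDerivAt gb s))
      refine h1.congr_deriv ?_
      have e1 := hT.inner_generator (hv s) (hT.mem_graph ga s)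
      have e2 := hT'.inner_generator (hw s) (hT'.mem_graph gb s)
      simp only [LinearIsometry.coe_toContinuousLinearMap] at e1 e2 ⊢
      simp only [inner_add_left, inner_add_right, inner_hilbertTmul]
      linear_combination ⟪w s, T' s b⟫_ℝ * e1 + ⟪v s, T s a⟫_ℝ * e2
    have hc := is_const_of_deriv_eq_zero (fun s => (hd s).differentiableAt)
      (fun s => (hd s).deriv) t 0
    have e0 : T 0 a = a := DFunLike.congr_fun hT.map_zero a
    have e0' : T' 0 b = b := DFunLike.congr_fun hT'.map_zero b
    simp only [e0, e0'] at hc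
    rw [hc]
    simp only [inner_hilbertTmul, LinearIsometry.inner_map_map]
  have hsurj : ∀ x, T t (T (-t) x) = x := fun x => by
    have := hT.map_add t (-t)
    rw [add_neg_cancel, hT.map_zero] at this
    exact (DFunLike.congr_fun this x).symm
  have hsurj' : ∀ x, T' t (T' (-t) x) = x := fun x => by
    have := hT'.map_add t (-t)
    rw [add_neg_cancel, hT'.map_zero] at this
    exact (DFunLike.congr_fun this x).symm
  rw [← sub_eq_zero]
  refine eq_zero_of_inner_hilbertTmul fun x y => ?_
  have key : ∀ p : V × W, ⟪hilbertTmul V W (v t) (w t) -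
      hilbertTmul V W (T t (v 0)) (T' t (w 0)), hilbertTmul V W (T t p.1) (T' t p.2)⟫_ℝ = 0 := by
    have hcl : IsClosed {p : V × W | ⟪hilbertTmul V W (v t) (w t) -
        hilbertTmul V W (T t (v 0)) (T' t (w 0)),
        hilbertTmul V W (T t p.1) (T' t p.2)⟫_ℝ = 0} := by
      refine isClosed_eq ?_ continuous_const
      have := (T t).continuous
      have := (T' t).continuous
      fun_prop
    refine fun p => hcl.closure_subset_iff.2 ?_ ((hG.prod hG') p)
    rintro ⟨a, b⟩ ⟨ha, hb⟩
    rw [Set.mem_ofPred_eq, inner_sub_left, hconst a ha b hb, sub_self]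
  have := key (T (-t) x, T' (-t) y)
  rwa [hsurj, hsurj'] at this

end TensorEvolution

section JordanSchrodinger

variable {Ep Em : Type*}
  [NormedAddCommGroup Ep] [InnerProductSpace ℂ Ep] [CompleteSpace Ep]
  [NormedAddCommGroup Em] [InnerProductSpace ℂ Em] [CompleteSpace Em]
  {φp : HilbertBasis ℕ ℂ Ep} {φm : HilbertBasis ℕ ℂ Em}

theorem smul_mem_graph {V : Type*} [AddCommGroup V] [Module ℝ V] {K : V →ₗ.[ℝ] V} (c : ℝ) {x y : V}
    (h : (x, y) ∈ K.graph) : (x, c • y) ∈ (c • K).graph := by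
  obtain ⟨z, rfl, rfl⟩ := (LinearPMap.mem_graph_iff _).1 h
  exact (c • K).mem_graph z

theorem solvesJordanSchrodinger_of_hasDerivAt {ħ : ℝ} {Kp : JordanHS φp →ₗ.[ℝ] JordanHS φp}
    {Km : JordanHS φm →ₗ.[ℝ] JordanHS φm} {v : ℝ → JordanHS φp} {w : ℝ → JordanHS φm}
    (hv : ∀ t, v t ∈ Kp.domain) (hw : ∀ t, w t ∈ Km.domain)
    (hv' : ∀ t, HasDerivAt v ((-(4 / ħ)) • Kp ⟨v t, hv t⟩) t)
    (hw' : ∀ t, HasDerivAt w ((-(4 / ħ)) • Km ⟨w t, hw t⟩) t) :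
    SolvesJordanSchrodinger ħ Kp Km v w where
  mem_left := hv
  mem_right := hw
  hasDerivAt t := by
    refine (hasDerivAt_hilbertTmul (hv' t) (hw' t)).congr_deriv ?_
    rw [map_smul, map_smul, smul_apply, smul_add]
    rfl

variable (φp) in
theorem hasDerivAt_oscillatorConj {ħ m Ω : ℝ} (hħ : 0 < ħ) (hm : 0 < m) (hΩ : 0 < Ω)
    {v u : JordanHS φp} (h : (v, u) ∈ (jordanK φp ħ m Ω).closure.graph) (t : ℝ) :
    HasDerivAt (fun s => oscillatorConj φp Ω s v) ((-(4 / ħ)) • oscillatorConj φp Ω t u) t := by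
  have h1 := (isOpExp_oscillatorConj φp hħ hm hΩ).hasDerivAt (smul_mem_graph (-(4 / ħ)) h) t
  rwa [LinearIsometry.coe_toContinuousLinearMap, map_smul] at h1

variable (φp) in
theorem oscillatorConj_mem_graph {ħ m Ω : ℝ} (hħ : 0 < ħ) (hm : 0 < m) (hΩ : 0 < Ω)
    {v u : JordanHS φp} (h : (v, u) ∈ (jordanK φp ħ m Ω).closure.graph) (t : ℝ) :
    (oscillatorConj φp Ω t v, oscillatorConj φp Ω t u) ∈ (jordanK φp ħ m Ω).closure.graph := by
  have h1 := (isOpExp_oscillatorConj φp hħ hm hΩ).mem_graph (smul_mem_graph (-(4 / ħ)) h) t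
  have ha : -(4 / ħ) ≠ 0 := by simp [hħ.ne']
  rwa [mem_graph_smul_iff ha, LinearIsometry.coe_toContinuousLinearMap, map_smul,
    inv_smul_smul₀ ha] at h1

/-- If `K₀` is a restriction of the closure of `jordanK` whose domain contains the orbit of `v`,
then the orbit is differentiable with derivative given by `K₀`. -/
theorem hasDerivAt_oscillatorConj_of_le {ħ m Ω : ℝ} (hħ : 0 < ħ) (hm : 0 < m) (hΩ : 0 < Ω)
    {K₀ : JordanHS φp →ₗ.[ℝ] JordanHS φp} (hK : K₀ ≤ (jordanK φp ħ m Ω).closure)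
    {v : JordanHS φp} (hv : ∀ t, oscillatorConj φp Ω t v ∈ K₀.domain) (t : ℝ) :
    HasDerivAt (fun s => oscillatorConj φp Ω s v)
      ((-(4 / ħ)) • K₀ ⟨oscillatorConj φp Ω t v, hv t⟩) t := by
  have h0 : oscillatorConj φp Ω 0 v = v :=
    DFunLike.congr_fun (isOpExp_oscillatorConj φp hħ hm hΩ).map_zero v
  have hv0 : v ∈ (jordanK φp ħ m Ω).closure.domain := hK.1 (h0 ▸ hv 0)
  have hg := (jordanK φp ħ m Ω).closure.mem_graph ⟨v, hv0⟩
  have h1 := hasDerivAt_oscillatorConj φp hħ hm hΩ hg t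
  have h2 := oscillatorConj_mem_graph φp hħ hm hΩ hg t
  have h3 := LinearPMap.le_graph_of_le hK (K₀.mem_graph ⟨_, hv t⟩)
  rwa [LinearPMap.mem_graph_snd_inj _ h2 h3 rfl] at h1

end JordanSchrodinger

end

theorem theorem4 {Ep Em : Type*}
    [NormedAddCommGroup Ep] [InnerProductSpace ℂ Ep] [CompleteSpace Ep]
    [NormedAddCommGroup Em] [InnerProductSpace ℂ Em] [CompleteSpace Em]
    (φp : HilbertBasis ℕ ℂ Ep) (φm : HilbertBasis ℕ ℂ Em)
    (ħ m Ωp Ωm : ℝ) (hħ : 0 < ħ) (hm : 0 < m) (hΩp : 0 < Ωp) (hΩm : 0 < Ωm) :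
    -- the two subsystem Hamiltonians as sums of commutators
    (hamiltonian φp ħ Ωp =
      Complex.I • ⁅opR1 φp ħ m Ωp, opS1 φp ħ m Ωp⁆ + Complex.I • ⁅opR2 φp ħ m Ωp, opS2 φp⁆) ∧
    (hamiltonian φm ħ Ωm =
      Complex.I • ⁅opR1 φm ħ m Ωm, opS1 φm ħ m Ωm⁆ + Complex.I • ⁅opR2 φm ħ m Ωm, opS2 φm⁆) ∧
    -- the unitary evolutions `exp (-i t H / ħ)` exist and are unique
    ((toUnbounded φp (hamiltonian φp ħ Ωp)).IsClosable ∧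
      ∃! U : ℝ → Ep →L[ℂ] Ep, IsOpExp (schrodingerGen φp ħ Ωp) U) ∧
    ((toUnbounded φm (hamiltonian φm ħ Ωm)).IsClosable ∧
      ∃! U : ℝ → Em →L[ℂ] Em, IsOpExp (schrodingerGen φm ħ Ωm) U) ∧
    -- the Jordan exponentials `exp (-(4 t / ħ) K)` exist and are unique
    ((jordanK φp ħ m Ωp).IsClosable ∧
      ∃! T : ℝ → JordanHS φp →L[ℝ] JordanHS φp,
        IsOpExp ((-(4 / ħ)) • (jordanK φp ħ m Ωp).closure) T) ∧
    ((jordanK φm ħ m Ωm).IsClosable ∧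
      ∃! T : ℝ → JordanHS φm →L[ℝ] JordanHS φm,
        IsOpExp ((-(4 / ħ)) • (jordanK φm ħ m Ωm).closure) T) ∧
    -- for every state vector, the quantum time evolution is the tensor product of exponentials
    (∀ (v : JordanHS φp) (w : JordanHS φm) (t : ℝ),
      opTensor (jordanEvolution φp ħ m Ωp t v).op (jordanEvolution φm ħ m Ωm t w).op =
        opTensor (unitaryEvolution φp ħ Ωp t) (unitaryEvolution φm ħ Ωm t) ∘L
          opTensor v.op w.op ∘L
          opTensor (ContinuousLinearMap.adjoint (unitaryEvolution φp ħ Ωp t))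
            (ContinuousLinearMap.adjoint (unitaryEvolution φm ħ Ωm t))) ∧
    -- it satisfies the Jordan–Schrödinger equation, for initial data in the domains
    (∀ v ∈ (jordanK φp ħ m Ωp).closure.domain, ∀ w ∈ (jordanK φm ħ m Ωm).closure.domain,
      SolvesJordanSchrodinger ħ (jordanK φp ħ m Ωp).closure (jordanK φm ħ m Ωm).closure
        (fun t => jordanEvolution φp ħ m Ωp t v) (fun t => jordanEvolution φm ħ m Ωm t w)) ∧
    -- without closures, for initial data with finitely many nonzero matrix elements
    (∀ (v : JordanHS φp) (w : JordanHS φm) (N : ℕ), (∀ n ≥ N, v.op (φp n) = 0) →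
      (∀ n ≥ N, w.op (φm n) = 0) →
      SolvesJordanSchrodinger ħ (jordanK φp ħ m Ωp) (jordanK φm ħ m Ωm)
        (fun t => jordanEvolution φp ħ m Ωp t v) (fun t => jordanEvolution φm ħ m Ωm t w)) ∧
    -- and every solution is of this form
    (∀ (v : ℝ → JordanHS φp) (w : ℝ → JordanHS φm),
      SolvesJordanSchrodinger ħ (jordanK φp ħ m Ωp).closure (jordanK φm ħ m Ωm).closure v w →
      ∀ t, stateTensor (v t) (w t) =
        stateTensor (jordanEvolution φp ħ m Ωp t (v 0)) (jordanEvolution φm ħ m Ωm t (w 0))) := by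

  have hep := jordanEvolution_eq φp hħ hm hΩp
  have hem := jordanEvolution_eq φm hħ hm hΩm
  have hopp := isOpExp_oscillatorConj φp hħ hm hΩp
  have hopm := isOpExp_oscillatorConj φm hħ hm hΩm
  refine ⟨hamiltonian_eq_commutators φp hħ hm hΩp, hamiltonian_eq_commutators φm hħ hm hΩm,
    ⟨isClosable_hamiltonian φp ħ Ωp, _, isOpExp_oscillatorUnitary φp hħ Ωp,
      fun _ => isOpExp_schrodingerGen_unique φp hħ Ωp⟩,
    ⟨isClosable_hamiltonian φm ħ Ωm, _, isOpExp_oscillatorUnitary φm hħ Ωm,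
      fun _ => isOpExp_schrodingerGen_unique φm hħ Ωm⟩,
    ⟨isClosable_jordanK φp hħ hm hΩp, _, hopp, fun _ => isOpExp_jordanGen_unique φp hħ hm hΩp⟩,
    ⟨isClosable_jordanK φm hħ hm hΩm, _, hopm, fun _ => isOpExp_jordanGen_unique φm hħ hm hΩm⟩,
    ?_, ?_, ?_, ?_⟩
  · intro v w t
    rw [hep, hem, unitaryEvolution_eq φp hħ, unitaryEvolution_eq φm hħ]
    simp only [LinearIsometry.coe_toContinuousLinearMap, op_oscillatorConj]
    rw [opTensor, TensorProduct.mapL_comp, TensorProduct.mapL_comp]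
  · intro v hv w hw
    rw [hep, hem]
    have hv' := fun t => LinearPMap.mem_domain_of_mem_graph (oscillatorConj_mem_graph φp hħ hm hΩp
      (LinearPMap.mem_graph _ ⟨v, hv⟩) t)
    have hw' := fun t => LinearPMap.mem_domain_of_mem_graph (oscillatorConj_mem_graph φm hħ hm hΩm
      (LinearPMap.mem_graph _ ⟨w, hw⟩) t)
    exact solvesJordanSchrodinger_of_hasDerivAt hv' hw'
      (hasDerivAt_oscillatorConj_of_le hħ hm hΩp le_rfl hv')
      (hasDerivAt_oscillatorConj_of_le hħ hm hΩm le_rfl hw')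
  · intro v w N hv hw
    rw [hep, hem]
    have hv' : ∀ t, oscillatorConj φp Ωp t v ∈ (jordanK φp ħ m Ωp).domain := fun t =>
      mem_domain_jordanK_of_finite ħ m Ωp (N := N) fun n hn =>
        op_oscillatorConj_basis_eq_zero φp Ωp t (hv n hn)
    have hw' : ∀ t, oscillatorConj φm Ωm t w ∈ (jordanK φm ħ m Ωm).domain := fun t =>
      mem_domain_jordanK_of_finite ħ m Ωm (N := N) fun n hn =>
        op_oscillatorConj_basis_eq_zero φm Ωm t (hw n hn)
    exact solvesJordanSchrodinger_of_hasDerivAt hv' hw'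
      (hasDerivAt_oscillatorConj_of_le hħ hm hΩp (LinearPMap.le_closure _) hv')
      (hasDerivAt_oscillatorConj_of_le hħ hm hΩm (LinearPMap.le_closure _) hw')
  · intro v w h t
    rw [hep, hem]
    refine hilbertTmul_eq_of_hasDerivAt hopp (dense_domain_jordanGen φp ħ m Ωp) hopm
      (dense_domain_jordanGen φm ħ m Ωm)
      (fun t => smul_mem_graph _ (LinearPMap.mem_graph _ ⟨v t, h.mem_left t⟩))
      (fun t => smul_mem_graph _ (LinearPMap.mem_graph _ ⟨w t, h.mem_right t⟩)) (fun t => ?_) t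
    refine (h.hasDerivAt t).congr_deriv ?_
    rw [map_smul, map_smul, smul_apply, smul_add]
    rfl
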